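/- Let $G$ be a finite simple connected bipartite planar graph with at least two vertices and maximum degree at most $3$, and let $X$, $Y$ be the two parts of its bipartition. Let $G^{[\sharp 2]}$ be the exact square of $G$, that is, the graph on $V(G)$ in which two vertices are adjacent if and only if their distance in $G$ is exactly $2$. Then $G^{[\sharp 2]}$ has exactly two connected components, one with vertex set $X$ and the other with vertex set $Y$, and both components are planar. Moreover, if $G$ is outerplanar (it can be drawn in the plane without crossings so that every vertex lies on the boundary of the outer face), then both components are outerplanar. -/

import Mathlib

/-- The Euclidean plane. -/
abbrev Plane : Type := EuclideanSpace ℝ (Fin 2)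

/-- `S` is a polygonal arc with ends `p` and `q`: the union of the segments
`[x 0, x 1], …, [x (n-1), x n]` of a simple (not self-intersecting) polygonal chain
with `x 0 = p` and `x n = q`. -/
def IsPolygonalArc (S : Set Plane) (p q : Plane) : Prop :=
  ∃ (n : ℕ) (x : ℕ → Plane), 0 < n ∧ x 0 = p ∧ x n = q ∧
    S = ⋃ i ∈ Set.Iio n, segment ℝ (x i) (x (i + 1)) ∧
    (∀ i < n, x i ≠ x (i + 1)) ∧
    (∀ i, i + 1 < n →
      segment ℝ (x i) (x (i + 1)) ∩ segment ℝ (x (i + 1)) (x (i + 2)) = {x (i + 1)}) ∧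
    (∀ i j, i + 1 < j → j < n →
      Disjoint (segment ℝ (x i) (x (i + 1))) (segment ℝ (x j) (x (j + 1))))

namespace SimpleGraph

/-- A drawing of `G` in the plane without crossings (a plane graph, with edges drawn as polygonal
arcs): vertices are distinct points, every edge is an arc between its two ends, no edge passes
through a vertex other than its ends, and two different edges meet at most in common ends. -/
structure PlaneDrawing {V : Type*} (G : SimpleGraph V) where
  /-- the point that represents a vertex -/
  pos : V → Plane
  /-- the arc that represents an edge (only the values at edges of `G` matter) -/
  arc : Sym2 V → Set Plane
  pos_injective : Function.Injective pos
  isPolygonalArc : ∀ u v, G.Adj u v → IsPolygonalArc (arc s(u, v)) (pos u) (pos v)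
  vertex_on_arc : ∀ e ∈ G.edgeSet, ∀ w, pos w ∈ arc e → w ∈ e
  arc_inter_arc : ∀ e ∈ G.edgeSet, ∀ f ∈ G.edgeSet, e ≠ f →
    arc e ∩ arc f ⊆ pos '' {w | w ∈ e ∧ w ∈ f}

namespace PlaneDrawing

variable {V : Type*} {G : SimpleGraph V}

/-- The set of all points of the drawing. -/
def carrier (D : G.PlaneDrawing) : Set Plane :=
  Set.range D.pos ∪ ⋃ e ∈ G.edgeSet, D.arc e

/-- The outer face: the unbounded connected component of the complement of the drawing. -/
def outerFace (D : G.PlaneDrawing) : Set Plane :=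
  {x | x ∈ D.carrierᶜ ∧ ¬ Bornology.IsBounded (connectedComponentIn D.carrierᶜ x)}

end PlaneDrawing

/-- `G` can be drawn in the plane without crossings. -/
def IsPlanar {V : Type*} (G : SimpleGraph V) : Prop :=
  Nonempty G.PlaneDrawing

/-- `G` can be drawn in the plane without crossings so that every vertex lies on the boundary of
the outer face. -/
def IsOuterplanar {V : Type*} (G : SimpleGraph V) : Prop :=
  ∃ D : G.PlaneDrawing, ∀ v, D.pos v ∈ frontier D.outerFace

/-- Every vertex has degree at most `3`. -/
def IsSubcubic {V : Type*} (G : SimpleGraph V) : Prop :=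
  ∀ v, (G.neighborSet v).encard ≤ 3

/-- The exact square of `G`: same vertices, adjacent when at distance exactly `2` in `G`. -/
def exactSquare {V : Type*} (G : SimpleGraph V) : SimpleGraph V where
  Adj u v := G.dist u v = 2
  symm := ⟨fun u v h => by rw [G.dist_comm]; exact h⟩
  loopless := ⟨fun v h => by simp at h⟩

end SimpleGraph

/-! Among at most three edges at a vertex `y`, any two are consecutive in the cyclic order. So if
`u` and `v` are distinct neighbours of `y`, one of the angles between `yu` and `yv` contains no
further edge. The face filling that angle touches both edges, hence by following them also `u` and
`v`, and a new edge `uv` can be drawn inside it (`exists_common_face`,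
`exists_isPolygonalArc_of_mem_closure`).

For `y` in `Y` the new edge has both ends in `X`, so no vertex of `Y` gains an edge and the argument
can be repeated. A maximal plane supergraph of `G` obtained by adding only edges inside `X` thus
contains the whole exact square on `X` (`exists_square`). Restricting its drawing to `X` gives
planarity; `Y` is symmetric. Connectedness of the exact square on each part comes from reading a
walk of `G` two steps at a time.

In the outerplanar case a closed barrier `K` is fixed first (`exists_barrier`). It meets the drawing
only in points of `X` and joins each of them to infinity. New edges are drawn in components of the
complement of drawing and barrier, so they never cut a vertex of `X` off from the outer face. -/

open Set Filter Topology

/-! ### Polar coordinates and sectors: the faces around a point -/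

/-- Polar coordinates around `p`. -/
noncomputable def polar (p : Plane) (x : ℝ × ℝ) : Plane :=
  p + x.1 • !₂[Real.cos x.2, Real.sin x.2]

/-- The ray with origin `p` and angle `θ`. -/
def spoke (p : Plane) (θ : ℝ) : Set Plane := {q | ∃ ρ : ℝ, 0 ≤ ρ ∧ q = polar p (ρ, θ)}

/-- The open circular sector around `p` of radius `r` between the angles `α` and `β`. -/
def sector (p : Plane) (α β r : ℝ) : Set Plane := polar p '' (Ioo 0 r ×ˢ Ioo α β)

theorem continuous_polar (p : Plane) : Continuous (polar p) := by
  unfold polar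
  refine continuous_const.add (continuous_fst.smul ?_)
  refine (PiLp.continuous_toLp 2 _).comp (continuous_pi fun i => ?_)
  fin_cases i <;> simp <;> fun_prop

theorem dist_polar (p : Plane) (ρ θ : ℝ) : dist (polar p (ρ, θ)) p = |ρ| := by
  simp [polar, dist_eq_norm, norm_smul, EuclideanSpace.norm_eq]

theorem polar_zero (p : Plane) (θ : ℝ) : polar p (0, θ) = p := by simp [polar]

theorem polar_add_two_pi (p : Plane) (ρ θ : ℝ) :
    polar p (ρ, θ + 2 * Real.pi) = polar p (ρ, θ) := by simp [polar]

/-- The base angle `b` is left free so that angles can be measured from any chosen spoke, which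
turns cyclic order into linear order. -/
theorem exists_polar_eq {p q : Plane} (h : q ≠ p) (b : ℝ) :
    ∃ ρ : ℝ, 0 < ρ ∧ ∃ θ ∈ Ico b (b + 2 * Real.pi), q = polar p (ρ, θ) := by
  set w : ℂ := ⟨(q - p) 0, (q - p) 1⟩ with hw
  have hw0 : w ≠ 0 := by
    intro h0
    apply h
    have h1 := congrArg Complex.re h0
    have h2 := congrArg Complex.im h0
    simp [hw] at h1 h2
    ext i
    fin_cases i
    · simpa using sub_eq_zero.mp h1
    · simpa using sub_eq_zero.mp h2
  refine ⟨‖w‖, norm_pos_iff.mpr hw0, toIcoMod Real.two_pi_pos b w.arg,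
    toIcoMod_mem_Ico _ _ _, ?_⟩
  have hc : Real.cos (toIcoMod Real.two_pi_pos b w.arg) = Real.cos w.arg := by
    rw [toIcoMod, zsmul_eq_mul, Real.cos_sub_int_mul_two_pi]
  have hs : Real.sin (toIcoMod Real.two_pi_pos b w.arg) = Real.sin w.arg := by
    rw [toIcoMod, zsmul_eq_mul, Real.sin_sub_int_mul_two_pi]
  have h1 : ‖w‖ * Real.cos w.arg = q 0 - p 0 := by
    rw [Complex.norm_mul_cos_arg]; simp [hw]
  have h2 : ‖w‖ * Real.sin w.arg = q 1 - p 1 := by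
    rw [Complex.norm_mul_sin_arg]; simp [hw]
  ext i
  fin_cases i
  · simp [polar, hc, h1]
  · simp [polar, hs, h2]

theorem polar_inj {p : Plane} {b ρ ρ' θ θ' : ℝ} (hρ : 0 < ρ) (hρ' : 0 ≤ ρ')
    (hθ : θ ∈ Ico b (b + 2 * Real.pi)) (hθ' : θ' ∈ Ico b (b + 2 * Real.pi))
    (h : polar p (ρ, θ) = polar p (ρ', θ')) : ρ = ρ' ∧ θ = θ' := by
  have hd := dist_polar p ρ θ
  rw [h, dist_polar, abs_of_pos hρ, abs_of_nonneg hρ'] at hd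
  subst hd
  refine ⟨rfl, ?_⟩
  have h0 : Real.cos θ = Real.cos θ' := by
    have := congrArg (fun v : Plane => v 0) h
    simpa [polar, hρ.ne'] using this
  have h1 : Real.sin θ = Real.sin θ' := by
    have := congrArg (fun v : Plane => v 1) h
    simpa [polar, hρ.ne'] using this
  have := Real.Angle.cos_sin_inj h0 h1
  rw [Real.Angle.angle_eq_iff_two_pi_dvd_sub] at this
  obtain ⟨k, hk⟩ := this
  have hpi := Real.pi_pos
  have hk1 : (k : ℝ) < 1 := by
    have := hθ.2; have := hθ'.1; nlinarith
  have hk2 : (-1 : ℝ) < k := by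
    have := hθ.1; have := hθ'.2; nlinarith
  have : k = 0 := by
    have a : k < 1 := by exact_mod_cast hk1
    have b : -1 < k := by exact_mod_cast hk2
    omega
  subst this
  simp at hk
  linarith

theorem polar_notMem_spoke {p : Plane} {b ρ θ θ' : ℝ} (hρ : 0 < ρ)
    (hθ : θ ∈ Ico b (b + 2 * Real.pi)) (hθ' : θ' ∈ Ico b (b + 2 * Real.pi)) (hne : θ ≠ θ') :
    polar p (ρ, θ) ∉ spoke p θ' := by
  rintro ⟨ρ', h0, h⟩
  exact hne (polar_inj hρ h0 hθ hθ' h).2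

theorem spoke_add_two_pi (p : Plane) (θ : ℝ) : spoke p (θ + 2 * Real.pi) = spoke p θ := by
  simp only [spoke, polar_add_two_pi]

theorem isPreconnected_sector (p : Plane) (α β r : ℝ) : IsPreconnected (sector p α β r) :=
  (isPreconnected_Ioo.prod isPreconnected_Ioo).image _ (continuous_polar p).continuousOn

theorem polar_mem_closure_sector (p : Plane) {α β r ρ θ : ℝ} (hαβ : α < β) (hr : 0 < r)
    (hρ : ρ ∈ Icc 0 r) (hθ : θ ∈ Icc α β) : polar p (ρ, θ) ∈ closure (sector p α β r) := by
  apply image_closure_subset_closure_image (continuous_polar p)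
  refine ⟨(ρ, θ), ?_, rfl⟩
  rw [closure_prod_eq, closure_Ioo hr.ne, closure_Ioo hαβ.ne]
  exact ⟨hρ, hθ⟩

theorem eventually_mem_closure_of_sector_subset {p : Plane} {F : Set Plane} {α β r θ : ℝ}
    (hαβ : α < β) (hr : 0 < r) (hF : sector p α β r ⊆ F) (hθ : θ ∈ Icc α β) :
    ∀ᶠ q in 𝓝 p, q ∈ spoke p θ → q ∈ closure F := by
  filter_upwards [Metric.ball_mem_nhds p hr] with q hq
  rintro ⟨ρ, h0, rfl⟩
  rw [Metric.mem_ball, dist_polar, abs_of_nonneg h0] at hq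
  exact closure_mono hF (polar_mem_closure_sector p hαβ hr ⟨h0, hq.le⟩ hθ)

theorem exists_sector_subset_compl {p : Plane} {C S : Set Plane} {α β : ℝ}
    (h : ∀ᶠ q in 𝓝 p, q ∈ C → q ∈ S)
    (hS : ∀ ρ > 0, ∀ θ ∈ Ioo α β, polar p (ρ, θ) ∉ S) :
    ∃ r₀ > 0, ∀ r ≤ r₀, sector p α β r ⊆ Cᶜ := by
  obtain ⟨r, hr, h⟩ := Metric.eventually_nhds_iff.mp h
  refine ⟨r, hr, ?_⟩
  rintro r' hr' _ ⟨⟨ρ, θ⟩, ⟨hρ, hθ⟩, rfl⟩ hC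
  refine hS ρ hρ.1 θ hθ (h ?_ hC)
  rw [dist_polar, abs_of_pos hρ.1]
  exact hρ.2.trans_le hr'

theorem subset_connectedComponentIn_of_mem {S C : Set Plane} {z q : Plane} (hS : IsPreconnected S)
    (hSC : S ⊆ C) (hq : q ∈ S) (hqz : q ∈ connectedComponentIn C z) :
    S ⊆ connectedComponentIn C z := by
  rw [connectedComponentIn_eq hqz]
  exact hS.subset_connectedComponentIn hq hSC

/-- If near `p` the set `C` consists of two spokes, then every component of the complement that
reaches `p` reaches both spokes. -/
theorem eventually_mem_closure_of_two_spokes {p z : Plane} {C : Set Plane} {θ₁ θ₂ : ℝ}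
    (h₁ : θ₁ < θ₂) (h₂ : θ₂ < θ₁ + 2 * Real.pi)
    (hC : ∀ᶠ q in 𝓝 p, (q ∈ C ↔ q ∈ spoke p θ₁ ∪ spoke p θ₂))
    (hp : p ∈ closure (connectedComponentIn Cᶜ z)) :
    ∀ᶠ q in 𝓝 p, q ∈ C → q ∈ closure (connectedComponentIn Cᶜ z) := by
  have hm₂ : θ₂ ∈ Ico θ₁ (θ₁ + 2 * Real.pi) := ⟨h₁.le, h₂⟩
  have hm₁ : θ₁ ∈ Ico θ₁ (θ₁ + 2 * Real.pi) := ⟨le_rfl, h₁.trans h₂⟩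
  obtain ⟨r₁, hr₁, hs₁⟩ := exists_sector_subset_compl (α := θ₁) (β := θ₂)
    (hC.mono fun q h => h.mp) (by
      rintro ρ hρ θ hθ (h | h)
      · exact polar_notMem_spoke hρ ⟨hθ.1.le, hθ.2.trans h₂⟩ hm₁ hθ.1.ne' h
      · exact polar_notMem_spoke hρ ⟨hθ.1.le, hθ.2.trans h₂⟩ hm₂ hθ.2.ne h)
  obtain ⟨r₂, hr₂, hs₂⟩ := exists_sector_subset_compl (α := θ₂) (β := θ₁ + 2 * Real.pi)
    (hC.mono fun q h => h.mp) (by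
      rintro ρ hρ θ hθ (h | h)
      · exact polar_notMem_spoke hρ ⟨(h₁.trans hθ.1).le, hθ.2⟩ hm₁ (h₁.trans hθ.1).ne' h
      · exact polar_notMem_spoke hρ ⟨(h₁.trans hθ.1).le, hθ.2⟩ hm₂ hθ.1.ne' h)
  set r := min r₁ r₂
  have hr : 0 < r := lt_min hr₁ hr₂
  -- A point of the component near `p` lies in one of the two open sectors, and each sector has both
  -- spokes on its boundary.
  obtain ⟨q, ⟨hqr, hqC⟩, hqF⟩ := mem_closure_iff_nhds.mp hp _
    (inter_mem (Metric.ball_mem_nhds p hr) hC)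
  have hqC' : q ∉ spoke p θ₁ ∪ spoke p θ₂ := fun h =>
    connectedComponentIn_subset _ _ hqF (hqC.mpr h)
  have hqp : q ≠ p := by
    rintro rfl
    exact hqC' (Or.inl ⟨0, le_rfl, (polar_zero _ _).symm⟩)
  obtain ⟨ρ, hρ, θ, hθ, rfl⟩ := exists_polar_eq hqp θ₁
  rw [Metric.mem_ball, dist_polar, abs_of_pos hρ] at hqr
  have hne₁ : θ ≠ θ₁ := by
    rintro rfl; exact hqC' (Or.inl ⟨ρ, hρ.le, rfl⟩)
  have hne₂ : θ ≠ θ₂ := by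
    rintro rfl; exact hqC' (Or.inr ⟨ρ, hρ.le, rfl⟩)
  have key : (∀ᶠ q in 𝓝 p, q ∈ spoke p θ₁ → q ∈ closure (connectedComponentIn Cᶜ z)) ∧
      ∀ᶠ q in 𝓝 p, q ∈ spoke p θ₂ → q ∈ closure (connectedComponentIn Cᶜ z) := by
    rcases lt_or_gt_of_ne hne₂ with hlt | hgt
    · have hsub := subset_connectedComponentIn_of_mem (isPreconnected_sector p θ₁ θ₂ r)
        (hs₁ r (min_le_left _ _)) (q := polar p (ρ, θ))
        ⟨(ρ, θ), ⟨⟨hρ, hqr⟩, ⟨lt_of_le_of_ne hθ.1 hne₁.symm, hlt⟩⟩, rfl⟩ hqF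
      exact ⟨eventually_mem_closure_of_sector_subset h₁ hr hsub (left_mem_Icc.mpr h₁.le),
        eventually_mem_closure_of_sector_subset h₁ hr hsub (right_mem_Icc.mpr h₁.le)⟩
    · have hsub := subset_connectedComponentIn_of_mem
        (isPreconnected_sector p θ₂ (θ₁ + 2 * Real.pi) r)
        (hs₂ r (min_le_right _ _)) (q := polar p (ρ, θ))
        ⟨(ρ, θ), ⟨⟨hρ, hqr⟩, ⟨hgt, hθ.2⟩⟩, rfl⟩ hqF
      refine ⟨?_, eventually_mem_closure_of_sector_subset h₂ hr hsub (left_mem_Icc.mpr h₂.le)⟩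
      rw [← spoke_add_two_pi]
      exact eventually_mem_closure_of_sector_subset h₂ hr hsub (right_mem_Icc.mpr h₂.le)
  filter_upwards [hC, key.1, key.2] with q h h1 h2 hq
  exact (h.mp hq).elim h1 h2

/-- If near `p` the set `C` is contained in three spokes, then some component of the complement
reaches the last two of them. -/
theorem exists_component_of_three_spokes {p : Plane} {C : Set Plane} {θ₀ θ₁ θ₂ : ℝ}
    (h₁ : θ₁ ∈ Ioo θ₀ (θ₀ + 2 * Real.pi)) (h₂ : θ₂ ∈ Ioo θ₀ (θ₀ + 2 * Real.pi)) (h₁₂ : θ₁ ≠ θ₂)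
    (hC : ∀ᶠ q in 𝓝 p, q ∈ C → q ∈ spoke p θ₀ ∪ spoke p θ₁ ∪ spoke p θ₂) :
    ∃ z, ∀ᶠ q in 𝓝 p, q ∈ spoke p θ₁ ∪ spoke p θ₂ → q ∈ closure (connectedComponentIn Cᶜ z) := by
  wlog hlt : θ₁ < θ₂ generalizing θ₁ θ₂
  · rw [union_comm]
    refine this h₂ h₁ h₁₂.symm ?_ (lt_of_le_of_ne (not_lt.mp hlt) h₁₂.symm)
    rwa [union_right_comm]
  have hm : ∀ {θ}, θ ∈ Ioo θ₀ (θ₀ + 2 * Real.pi) → θ ∈ Ico θ₀ (θ₀ + 2 * Real.pi) :=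
    fun h => ⟨h.1.le, h.2⟩
  -- Angles are measured from `θ₀`, so the sector from `θ₁` to `θ₂` is the one that misses the third
  -- spoke.
  obtain ⟨r, hr, hs⟩ := exists_sector_subset_compl (α := θ₁) (β := θ₂) hC (by
    intro ρ hρ θ hθ
    have hθ' : θ ∈ Ico θ₀ (θ₀ + 2 * Real.pi) := ⟨(h₁.1.trans hθ.1).le, hθ.2.trans h₂.2⟩
    rintro ((h | h) | h)
    · exact polar_notMem_spoke hρ hθ' (left_mem_Ico.mpr (h₁.1.trans h₁.2))
        (h₁.1.trans hθ.1).ne' h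
    · exact polar_notMem_spoke hρ hθ' (hm h₁) hθ.1.ne' h
    · exact polar_notMem_spoke hρ hθ' (hm h₂) hθ.2.ne h)
  specialize hs r le_rfl
  have hz : polar p (r / 2, (θ₁ + θ₂) / 2) ∈ sector p θ₁ θ₂ r :=
    ⟨(_, _), ⟨⟨by positivity, by simpa using hr⟩, by constructor <;> linarith⟩, rfl⟩
  have hsub := (isPreconnected_sector p θ₁ θ₂ r).subset_connectedComponentIn hz hs
  refine ⟨polar p (r / 2, (θ₁ + θ₂) / 2), ?_⟩
  filter_upwards [eventually_mem_closure_of_sector_subset hlt hr hsub (left_mem_Icc.mpr hlt.le),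
    eventually_mem_closure_of_sector_subset hlt hr hsub (right_mem_Icc.mpr hlt.le)] with q a b
  rintro (h | h)
  · exact a h
  · exact b h

/-! ### From spokes to segments issuing from a point -/

theorem eventually_mem_segment_iff_mem_spoke {p s : Plane} (h : s ≠ p) (b : ℝ) :
    ∃ θ ∈ Ico b (b + 2 * Real.pi), ∀ᶠ q in 𝓝 p, (q ∈ segment ℝ p s ↔ q ∈ spoke p θ) := by
  obtain ⟨R, hR, θ, hθ, rfl⟩ := exists_polar_eq h b
  refine ⟨θ, hθ, ?_⟩
  filter_upwards [Metric.ball_mem_nhds p hR] with q hq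
  rw [segment_eq_image']
  constructor
  · rintro ⟨t, ht, rfl⟩
    refine ⟨t * R, mul_nonneg ht.1 hR.le, ?_⟩
    simp [polar, smul_smul]
  · rintro ⟨ρ, hρ, rfl⟩
    rw [Metric.mem_ball, dist_polar, abs_of_nonneg hρ] at hq
    refine ⟨ρ / R, ⟨by positivity, (div_le_one hR).mpr hq.le⟩, ?_⟩
    have : ρ / R * R = ρ := by field_simp
    simp only [polar, add_sub_cancel_left, smul_smul, this]

theorem angle_ne_of_segment_inter {p s₁ s₂ : Plane} {θ₁ θ₂ : ℝ}
    (hi : segment ℝ p s₁ ∩ segment ℝ p s₂ ⊆ {p})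
    (h₁ : ∀ᶠ q in 𝓝 p, (q ∈ segment ℝ p s₁ ↔ q ∈ spoke p θ₁))
    (h₂ : ∀ᶠ q in 𝓝 p, (q ∈ segment ℝ p s₂ ↔ q ∈ spoke p θ₂)) : θ₁ ≠ θ₂ := by
  rintro rfl
  obtain ⟨r, hr, h⟩ := Metric.eventually_nhds_iff.mp (h₁.and h₂)
  have hd : dist (polar p (r / 2, θ₁)) p < r := by
    rw [dist_polar, abs_of_pos (by positivity)]; linarith
  have hm : polar p (r / 2, θ₁) ∈ spoke p θ₁ := ⟨_, by positivity, rfl⟩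
  have := hi ⟨(h hd).1.mpr hm, (h hd).2.mpr hm⟩
  have h0 := dist_polar p (r / 2) θ₁
  rw [mem_singleton_iff.mp this, dist_self, abs_of_pos (by positivity)] at h0
  linarith

theorem eventually_mem_closure_of_two_segments {p z s₁ s₂ : Plane} {C : Set Plane}
    (h₁ : s₁ ≠ p) (h₂ : s₂ ≠ p) (hi : segment ℝ p s₁ ∩ segment ℝ p s₂ ⊆ {p})
    (hC : ∀ᶠ q in 𝓝 p, (q ∈ C ↔ q ∈ segment ℝ p s₁ ∪ segment ℝ p s₂))
    (hp : p ∈ closure (connectedComponentIn Cᶜ z)) :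
    ∀ᶠ q in 𝓝 p, q ∈ C → q ∈ closure (connectedComponentIn Cᶜ z) := by
  obtain ⟨θ₁, -, H₁⟩ := eventually_mem_segment_iff_mem_spoke h₁ 0
  obtain ⟨θ₂, m₂, H₂⟩ := eventually_mem_segment_iff_mem_spoke h₂ θ₁
  have hne := angle_ne_of_segment_inter hi H₁ H₂
  refine eventually_mem_closure_of_two_spokes (lt_of_le_of_ne m₂.1 hne) m₂.2 ?_ hp
  filter_upwards [hC, H₁, H₂] with q a b c
  rw [a, mem_union, b, c, mem_union]

theorem exists_component_of_three_segments {p s₁ s₂ s₃ : Plane} {C : Set Plane}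
    (h₁ : s₁ ≠ p) (h₂ : s₂ ≠ p) (h₃ : s₃ ≠ p)
    (h₁₂ : segment ℝ p s₁ ∩ segment ℝ p s₂ ⊆ {p}) (h₁₃ : segment ℝ p s₁ ∩ segment ℝ p s₃ ⊆ {p})
    (h₂₃ : segment ℝ p s₂ ∩ segment ℝ p s₃ ⊆ {p})
    (hC : ∀ᶠ q in 𝓝 p, q ∈ C → q ∈ segment ℝ p s₁ ∪ segment ℝ p s₂ ∪ segment ℝ p s₃) :
    ∃ z, ∀ᶠ q in 𝓝 p, q ∈ segment ℝ p s₁ ∪ segment ℝ p s₂ →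
      q ∈ closure (connectedComponentIn Cᶜ z) := by
  obtain ⟨θ₀, -, H₀⟩ := eventually_mem_segment_iff_mem_spoke h₃ 0
  obtain ⟨θ₁, m₁, H₁⟩ := eventually_mem_segment_iff_mem_spoke h₁ θ₀
  obtain ⟨θ₂, m₂, H₂⟩ := eventually_mem_segment_iff_mem_spoke h₂ θ₀
  obtain ⟨z, hz⟩ := exists_component_of_three_spokes (C := C)
    ⟨lt_of_le_of_ne m₁.1 (angle_ne_of_segment_inter h₁₃ H₁ H₀).symm, m₁.2⟩
    ⟨lt_of_le_of_ne m₂.1 (angle_ne_of_segment_inter h₂₃ H₂ H₀).symm, m₂.2⟩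
    (angle_ne_of_segment_inter h₁₂ H₁ H₂) (by
      filter_upwards [hC, H₀, H₁, H₂] with q a b c d h
      have := a h
      rw [mem_union, mem_union, b, c, d] at this
      rw [mem_union, mem_union]
      tauto)
  refine ⟨z, ?_⟩
  filter_upwards [hz, H₁, H₂] with q a b c h
  apply a
  rwa [mem_union, ← b, ← c]

theorem exists_component_of_two_segments {p s₁ s₂ : Plane} {C : Set Plane}
    (h₁ : s₁ ≠ p) (h₂ : s₂ ≠ p) (h₁₂ : segment ℝ p s₁ ∩ segment ℝ p s₂ ⊆ {p})
    (hC : ∀ᶠ q in 𝓝 p, q ∈ C → q ∈ segment ℝ p s₁ ∪ segment ℝ p s₂) :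
    ∃ z, ∀ᶠ q in 𝓝 p, q ∈ segment ℝ p s₁ ∪ segment ℝ p s₂ →
      q ∈ closure (connectedComponentIn Cᶜ z) := by
  obtain ⟨θ₁, -, H₁⟩ := eventually_mem_segment_iff_mem_spoke h₁ 0
  obtain ⟨θ₂, m₂, H₂⟩ := eventually_mem_segment_iff_mem_spoke h₂ θ₁
  have hlt := lt_of_le_of_ne m₂.1 (angle_ne_of_segment_inter h₁₂ H₁ H₂)
  have hlt' := m₂.2
  -- A fictitious third spoke bisects the angle from `θ₁` to `θ₂`. The sector used is the
  -- complementary one, so `θ₁` is shifted by a full turn.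
  obtain ⟨z, hz⟩ := exists_component_of_three_spokes (C := C) (p := p)
    (θ₀ := (θ₁ + θ₂) / 2) (θ₁ := θ₁ + 2 * Real.pi) (θ₂ := θ₂)
    ⟨by linarith, by linarith⟩ ⟨by linarith, by linarith⟩ hlt'.ne' (by
      rw [spoke_add_two_pi]
      filter_upwards [hC, H₁, H₂] with q a b c h
      have := a h
      rw [mem_union, b, c] at this
      rw [mem_union, mem_union]
      tauto)
  refine ⟨z, ?_⟩
  rw [spoke_add_two_pi] at hz
  filter_upwards [hz, H₁, H₂] with q a b c h
  apply a
  rwa [mem_union, ← b, ← c]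

theorem isPreconnected_compl_ball (R : ℝ) (hR : 0 < R) :
    IsPreconnected (Metric.ball (0 : Plane) R)ᶜ := by
  have : (Metric.ball (0 : Plane) R)ᶜ = polar 0 '' (Ici R ×ˢ univ) := by
    ext q
    simp only [mem_compl_iff, Metric.mem_ball, not_lt, mem_image]
    constructor
    · intro h
      have hq : q ≠ 0 := by
        rintro rfl
        rw [dist_self] at h
        linarith
      obtain ⟨ρ, hρ, θ, -, rfl⟩ := exists_polar_eq hq 0
      rw [dist_polar, abs_of_pos hρ] at h
      exact ⟨(ρ, θ), ⟨h, mem_univ _⟩, rfl⟩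
    · rintro ⟨⟨ρ, θ⟩, ⟨h, -⟩, rfl⟩
      rw [dist_polar]
      exact le_trans h (le_abs_self _)
  rw [this]
  exact (isPreconnected_Ici.prod isPreconnected_univ).image _ (continuous_polar 0).continuousOn

/-! ### Segments and simple polygonal chains -/

theorem segment_union_segment_of_mem {a b z : Plane} (hz : z ∈ segment ℝ a b) :
    segment ℝ z a ∪ segment ℝ z b = segment ℝ a b := by
  rw [segment_eq_image_lineMap] at hz
  obtain ⟨t, ht, rfl⟩ := hz
  have key : ∀ u v : ℝ, u ≤ v → segment ℝ (AffineMap.lineMap a b u : Plane)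
      (AffineMap.lineMap a b v) = AffineMap.lineMap a b '' Icc u v := fun u v huv => by
    rw [← segment_eq_Icc huv, image_segment]
  have h0 := key 0 t ht.1
  have h1 := key t 1 ht.2
  have h2 := key 0 1 zero_le_one
  simp only [AffineMap.lineMap_apply_zero, AffineMap.lineMap_apply_one] at h0 h1 h2
  rw [segment_symm, h0, h1, h2, ← image_union, Icc_union_Icc_eq_Icc ht.1 ht.2]

theorem segment_inter_segment_of_mem {a b z : Plane} (hz : z ∈ segment ℝ a b) :
    segment ℝ z a ∩ segment ℝ z b ⊆ {z} := by
  rintro w ⟨h1, h2⟩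
  have e0 := dist_add_dist_of_mem_segment hz
  have e1 := dist_add_dist_of_mem_segment h1
  have e2 := dist_add_dist_of_mem_segment h2
  have e3 := dist_triangle a w b
  rw [dist_comm a z] at e0
  rw [dist_comm a w] at e3
  have : dist z w ≤ 0 := by linarith
  exact (dist_le_zero.mp this).symm

theorem isClosed_segment (a b : Plane) : IsClosed (segment ℝ a b) := by
  rw [segment_eq_image_lineMap]
  exact (isCompact_Icc.image AffineMap.lineMap_continuous).isClosed

theorem isCompact_segment (a b : Plane) : IsCompact (segment ℝ a b) := by
  rw [segment_eq_image_lineMap]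
  exact isCompact_Icc.image AffineMap.lineMap_continuous

/-- Only those members of a finite family of closed sets that contain `z` matter near `z`. -/
theorem eventually_forall_mem_imp {ι : Type*} {I : Set ι} (hI : I.Finite) {A : ι → Set Plane}
    (hA : ∀ i ∈ I, IsClosed (A i)) (z : Plane) :
    ∀ᶠ w in 𝓝 z, ∀ i ∈ I, w ∈ A i → z ∈ A i := by
  rw [eventually_all_finite hI]
  intro i hi
  by_cases hz : z ∈ A i
  · exact Eventually.of_forall fun _ _ => hz
  · filter_upwards [(hA i hi).isOpen_compl.mem_nhds hz] with w hw h
    exact absurd h hw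

/-- `x 0, …, x n` is a simple polygonal chain. -/
structure IsSimpleChain (n : ℕ) (x : ℕ → Plane) : Prop where
  ne : ∀ i < n, x i ≠ x (i + 1)
  inter : ∀ i, i + 1 < n →
    segment ℝ (x i) (x (i + 1)) ∩ segment ℝ (x (i + 1)) (x (i + 2)) = {x (i + 1)}
  disjoint : ∀ i j, i + 1 < j → j < n →
    Disjoint (segment ℝ (x i) (x (i + 1))) (segment ℝ (x j) (x (j + 1)))

/-- The union of the segments of a polygonal chain. -/
def chainSupport (n : ℕ) (x : ℕ → Plane) : Set Plane :=
  ⋃ i ∈ Iio n, segment ℝ (x i) (x (i + 1))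

theorem isPolygonalArc_iff {S : Set Plane} {p q : Plane} : IsPolygonalArc S p q ↔
    ∃ (n : ℕ) (x : ℕ → Plane), 0 < n ∧ x 0 = p ∧ x n = q ∧ S = chainSupport n x ∧
      IsSimpleChain n x :=
  ⟨fun ⟨n, x, h0, h1, h2, h3, h4, h5, h6⟩ => ⟨n, x, h0, h1, h2, h3, h4, h5, h6⟩,
    fun ⟨n, x, h0, h1, h2, h3, h⟩ => ⟨n, x, h0, h1, h2, h3, h.ne, h.inter, h.disjoint⟩⟩

theorem mem_chainSupport {n : ℕ} {x : ℕ → Plane} {z : Plane} :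
    z ∈ chainSupport n x ↔ ∃ i < n, z ∈ segment ℝ (x i) (x (i + 1)) := by
  simp [chainSupport]

theorem isCompact_chainSupport (n : ℕ) (x : ℕ → Plane) : IsCompact (chainSupport n x) :=
  (finite_Iio n).isCompact_biUnion fun _ _ => isCompact_segment _ _

namespace IsSimpleChain

variable {n : ℕ} {x : ℕ → Plane}

theorem eq_of_mem_of_mem (h : IsSimpleChain n x) {i j : ℕ} {z : Plane} (hij : i < j) (hj : j < n)
    (hi : z ∈ segment ℝ (x i) (x (i + 1))) (hzj : z ∈ segment ℝ (x j) (x (j + 1))) :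
    j = i + 1 ∧ z = x j := by
  rcases Nat.lt_or_ge (i + 1) j with h1 | h1
  · exact absurd hzj (disjoint_left.mp (h.disjoint i j h1 hj) hi)
  · have : j = i + 1 := by omega
    subst this
    have hz : z ∈ ({x (i + 1)} : Set Plane) := by
      rw [← h.inter i hj]; exact ⟨hi, hzj⟩
    exact ⟨rfl, hz⟩

theorem eq_or_of_mem (h : IsSimpleChain n x) {i k : ℕ} (hi : i < n) (hk : k ≤ n)
    (hz : x k ∈ segment ℝ (x i) (x (i + 1))) : k = i ∨ k = i + 1 := by
  by_contra! hne
  rcases Nat.lt_or_ge i k with hik | hik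
  · have hk1 : k - 1 + 1 = k := by omega
    have hmem : x k ∈ segment ℝ (x (k - 1)) (x (k - 1 + 1)) := by
      rw [hk1]; exact right_mem_segment _ _ _
    have := (h.eq_of_mem_of_mem (by omega : i < k - 1) (by omega) hz hmem).2
    have h2 := h.ne (k - 1) (by omega)
    rw [hk1] at h2
    exact h2 this.symm
  · have h1 := h.eq_of_mem_of_mem (by omega : k < i) hi (left_mem_segment _ _ _) hz
    have h2 := h.ne k (by omega)
    rw [← h1.1] at h2
    exact h2 h1.2

theorem injOn (h : IsSimpleChain n x) {i j : ℕ} (hij : i < j) (hj : j ≤ n) : x i ≠ x j := by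
  intro he
  have : x j ∈ segment ℝ (x i) (x (i + 1)) := he ▸ left_mem_segment _ _ _
  rcases h.eq_or_of_mem (by omega) hj this with h1 | h1
  · omega
  · subst h1
    exact h.ne i (by omega) he

theorem eventually_exists_mem (n : ℕ) (x : ℕ → Plane) (z : Plane) :
    ∀ᶠ w in 𝓝 z, w ∈ chainSupport n x → ∃ i < n, w ∈ segment ℝ (x i) (x (i + 1)) ∧
      z ∈ segment ℝ (x i) (x (i + 1)) := by
  filter_upwards [eventually_forall_mem_imp (finite_Iio n)
    (A := fun i => segment ℝ (x i) (x (i + 1))) (fun _ _ => isClosed_segment _ _) z] with w hw h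
  obtain ⟨i, hi, hm⟩ := mem_chainSupport.mp h
  exact ⟨i, hi, hm, hw i hi hm⟩

theorem reverse (h : IsSimpleChain n x) : IsSimpleChain n (fun i => x (n - i)) where
  ne i hi := by
    have := h.ne (n - (i + 1)) (by omega)
    rw [show n - (i + 1) + 1 = n - i by omega] at this
    exact this.symm
  inter i hi := by
    have := h.inter (n - (i + 2)) (by omega)
    rw [show n - (i + 2) + 1 = n - (i + 1) by omega, show n - (i + 2) + 2 = n - i by omega] at this
    rw [segment_symm ℝ (x (n - i)), segment_symm ℝ _ (x (n - (i + 2))), inter_comm, this]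
  disjoint i j hij hj := by
    have := h.disjoint (n - (j + 1)) (n - (i + 1)) (by omega) (by omega)
    rw [show n - (i + 1) + 1 = n - i by omega, show n - (j + 1) + 1 = n - j by omega] at this
    rw [segment_symm ℝ (x (n - i)), segment_symm ℝ (x (n - j))]
    exact this.symm

theorem chainSupport_reverse (n : ℕ) (x : ℕ → Plane) :
    chainSupport n (fun i => x (n - i)) = chainSupport n x := by
  ext z
  simp only [mem_chainSupport]
  constructor
  · rintro ⟨i, hi, hz⟩
    refine ⟨n - (i + 1), by omega, ?_⟩
    rwa [segment_symm, show n - (i + 1) + 1 = n - i by omega]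
  · rintro ⟨i, hi, hz⟩
    refine ⟨n - (i + 1), by omega, ?_⟩
    rwa [segment_symm, show n - (n - (i + 1)) = i + 1 by omega,
      show n - (n - (i + 1) + 1) = i by omega]

end IsSimpleChain

/-! ### Local structure and connectedness of polygonal arcs -/

namespace IsPolygonalArc

variable {S : Set Plane} {p q : Plane}

theorem symm (hA : IsPolygonalArc S p q) : IsPolygonalArc S q p := by
  rw [isPolygonalArc_iff] at hA ⊢
  obtain ⟨n, x, h0, rfl, rfl, rfl, h⟩ := hA
  exact ⟨n, fun i => x (n - i), h0, by simp, by simp,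
    (IsSimpleChain.chainSupport_reverse n x).symm, h.reverse⟩

theorem isCompact (hA : IsPolygonalArc S p q) : IsCompact S := by
  obtain ⟨n, x, -, -, -, rfl, -⟩ := isPolygonalArc_iff.mp hA
  exact isCompact_chainSupport n x

theorem left_mem (hA : IsPolygonalArc S p q) : p ∈ S := by
  obtain ⟨n, x, h0, rfl, -, rfl, -⟩ := isPolygonalArc_iff.mp hA
  exact mem_chainSupport.mpr ⟨0, h0, left_mem_segment _ _ _⟩

theorem eventually_eq_segment (hA : IsPolygonalArc S p q) : ∃ s, s ≠ p ∧ segment ℝ p s ⊆ S ∧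
    ∀ᶠ w in 𝓝 p, w ∈ S → w ∈ segment ℝ p s := by
  obtain ⟨n, x, h0, rfl, -, rfl, h⟩ := isPolygonalArc_iff.mp hA
  refine ⟨x 1, (h.ne 0 h0).symm, fun z hz => mem_chainSupport.mpr ⟨0, h0, hz⟩, ?_⟩
  filter_upwards [IsSimpleChain.eventually_exists_mem n x (x 0)] with w hw hS
  obtain ⟨i, hi, h1, h2⟩ := hw hS
  rcases h.eq_or_of_mem hi (Nat.zero_le _) h2 with h3 | h3
  · subst h3; exact h1
  · omega

/-- At a corner of the chain the two segments are the adjacent links; elsewhere they are the two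
halves of the link through `z`. -/
theorem eventually_iff_two_segments (hA : IsPolygonalArc S p q) {z : Plane} (hz : z ∈ S)
    (hp : z ≠ p) (hq : z ≠ q) : ∃ s₁ s₂, s₁ ≠ z ∧ s₂ ≠ z ∧
      segment ℝ z s₁ ∩ segment ℝ z s₂ ⊆ {z} ∧
      ∀ᶠ w in 𝓝 z, (w ∈ S ↔ w ∈ segment ℝ z s₁ ∪ segment ℝ z s₂) := by
  obtain ⟨n, x, h0, rfl, rfl, rfl, h⟩ := isPolygonalArc_iff.mp hA
  by_cases hv : ∃ k ≤ n, z = x k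
  · obtain ⟨k, hk, rfl⟩ := hv
    have hk0 : k ≠ 0 := by rintro rfl; exact hp rfl
    have hkn : k ≠ n := by rintro rfl; exact hq rfl
    obtain ⟨m, rfl⟩ := Nat.exists_eq_succ_of_ne_zero hk0
    have hm : m + 1 < n := by omega
    refine ⟨x m, x (m + 2), h.ne m (by omega), (h.ne (m + 1) hm).symm, ?_, ?_⟩
    · rw [segment_symm]; exact (h.inter m hm).subset
    · filter_upwards [IsSimpleChain.eventually_exists_mem n x (x (m + 1))] with w hw
      constructor
      · intro hS
        obtain ⟨i, hi, h1, h2⟩ := hw hS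
        rcases h.eq_or_of_mem hi hk h2 with h3 | h3
        · subst h3; exact Or.inr h1
        · obtain rfl : m = i := by omega
          left; rwa [segment_symm]
      · rintro (h1 | h1)
        · exact mem_chainSupport.mpr ⟨m, by omega, by rwa [segment_symm]⟩
        · exact mem_chainSupport.mpr ⟨m + 1, hm, h1⟩
  · push Not at hv
    obtain ⟨k, hk, hzk⟩ := mem_chainSupport.mp hz
    refine ⟨x k, x (k + 1), (hv k hk.le).symm, (hv (k + 1) hk).symm,
      segment_inter_segment_of_mem hzk, ?_⟩
    rw [segment_union_segment_of_mem hzk]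
    filter_upwards [IsSimpleChain.eventually_exists_mem n x z] with w hw
    refine ⟨fun hS => ?_, fun h1 => mem_chainSupport.mpr ⟨k, hk, h1⟩⟩
    obtain ⟨i, hi, h1, h2⟩ := hw hS
    rcases lt_trichotomy i k with hik | rfl | hik
    · exact absurd (h.eq_of_mem_of_mem hik hk h2 hzk).2 (hv k hk.le)
    · exact h1
    · exact absurd (h.eq_of_mem_of_mem hik hi hzk h2).2 (hv i hi.le)

/-- Each link without the two ends of the arc lies between an open segment and its closure, and
consecutive links share an inner corner. -/
theorem isPreconnected_diff_ends (hA : IsPolygonalArc S p q) : IsPreconnected (S \ {p, q}) := by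
  obtain ⟨n, x, h0, rfl, rfl, rfl, h⟩ := isPolygonalArc_iff.mp hA
  have hdiff : chainSupport n x \ {x 0, x n} =
      ⋃ i ∈ Iio n, segment ℝ (x i) (x (i + 1)) \ {x 0, x n} := by
    ext z; simp [chainSupport]; tauto
  rw [hdiff]
  refine IsPreconnected.biUnion_of_chain ordConnected_Iio (fun i hi => ?_) fun i hi hi1 => ?_
  · have hi : i < n := hi
    refine (convex_openSegment (x i) (x (i + 1))).isPreconnected.subset_closure
      (fun z hz => ⟨openSegment_subset_segment ℝ _ _ hz, ?_⟩) ?_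
    · have aux : ∀ k ≤ n, z ≠ x k := by
        rintro k hk rfl
        rcases h.eq_or_of_mem hi hk (openSegment_subset_segment ℝ _ _ hz) with rfl | rfl
        · exact h.ne k hi (left_mem_openSegment_iff.mp hz)
        · exact h.ne i hi (right_mem_openSegment_iff.mp hz)
      simpa using ⟨aux 0 (Nat.zero_le _), aux n le_rfl⟩
    · rw [closure_openSegment]
      exact sdiff_subset
  · have hi1 : i + 1 < n := hi1
    have hne : x (i + 1) ∉ ({x 0, x n} : Set Plane) := by
      simpa using ⟨(h.injOn (Nat.succ_pos i) hi1.le).symm, h.injOn hi1 le_rfl⟩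
    exact ⟨x (i + 1), ⟨right_mem_segment _ _ _, hne⟩, ⟨left_mem_segment _ _ _, hne⟩⟩

theorem left_mem_closure_diff_ends (hA : IsPolygonalArc S p q) : p ∈ closure (S \ {p, q}) := by
  obtain ⟨s, hs, hsub, -⟩ := hA.eventually_eq_segment
  have hp : p ∈ closure (openSegment ℝ p s \ {q}) := by
    have h1 : p ∈ closure (openSegment ℝ p s) := by
      rw [closure_openSegment]; exact left_mem_segment _ _ _
    obtain ⟨n, x, h0, rfl, rfl, -, h⟩ := isPolygonalArc_iff.mp hA
    refine mem_closure_iff_nhds.mpr fun t ht => ?_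
    obtain ⟨w, hw, hw'⟩ := mem_closure_iff_nhds.mp h1 _
      (inter_mem ht (isOpen_compl_singleton.mem_nhds (h.injOn h0 le_rfl)))
    exact ⟨w, hw.1, hw', hw.2⟩
  refine closure_mono (t := S \ {p, q}) (fun w hw => ?_) hp
  refine ⟨hsub (openSegment_subset_segment ℝ _ _ hw.1), ?_⟩
  rintro (rfl | h')
  · exact hs (left_mem_openSegment_iff.mp hw.1).symm
  · exact hw.2 h'

end IsPolygonalArc

/-! ### Boundary points accessible along a straight segment -/

/-- Near `p`, the set `C` is closed under moving away from `p`. -/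
def RadialAt (C : Set Plane) (p : Plane) : Prop :=
  ∀ᶠ q in 𝓝 p, ∀ t ∈ Ioc (0 : ℝ) 1, AffineMap.lineMap p q t ∈ C → q ∈ C

namespace RadialAt

theorem of_notMem {C : Set Plane} {p : Plane} (hC : IsClosed C) (hp : p ∉ C) : RadialAt C p := by
  obtain ⟨r, hr, h⟩ := Metric.isOpen_iff.mp hC.isOpen_compl p hp
  filter_upwards [Metric.ball_mem_nhds p hr] with q hq t ht hmem
  refine absurd hmem (h ?_)
  exact (convex_ball p r).segment_subset (Metric.mem_ball_self hr) hq
    (by rw [segment_eq_image_lineMap]; exact ⟨t, ⟨ht.1.le, ht.2⟩, rfl⟩)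

theorem empty (p : Plane) : RadialAt ∅ p := of_notMem isClosed_empty (notMem_empty p)

theorem union {C D : Set Plane} {p : Plane} (hC : RadialAt C p) (hD : RadialAt D p) :
    RadialAt (C ∪ D) p := by
  filter_upwards [hC, hD] with q h1 h2 t ht
  exact Or.imp (h1 t ht) (h2 t ht)

theorem biUnion {ι : Type*} {I : Set ι} (hI : I.Finite) {C : ι → Set Plane} {p : Plane}
    (h : ∀ i ∈ I, RadialAt (C i) p) : RadialAt (⋃ i ∈ I, C i) p := by
  filter_upwards [(eventually_all_finite hI).mpr h] with q hq t ht hm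
  simp only [mem_iUnion] at hm ⊢
  obtain ⟨i, hi, hm⟩ := hm
  exact ⟨i, hi, hq i hi t ht hm⟩

theorem segment_left (p s : Plane) : RadialAt (segment ℝ p s) p := by
  by_cases hs : s = p
  · subst hs
    refine Eventually.of_forall fun q t ht hm => ?_
    rw [segment_same, mem_singleton_iff, AffineMap.lineMap_eq_left_iff] at hm
    rw [segment_same]
    exact (hm.resolve_right ht.1.ne').symm
  · have hd : 0 < dist s p := dist_pos.mpr hs
    filter_upwards [Metric.ball_mem_nhds p hd] with q hq t ht hm
    rw [segment_eq_image'] at hm ⊢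
    obtain ⟨l, hl, he⟩ := hm
    have he' : q - p = (l / t) • (s - p) := by
      simp only [AffineMap.lineMap_apply, vsub_eq_sub, vadd_eq_add] at he
      have : t • (q - p) = l • (s - p) := by
        rw [add_comm] at he; exact (add_right_cancel he).symm
      rw [div_eq_inv_mul, mul_smul, ← this, smul_smul, inv_mul_cancel₀ ht.1.ne', one_smul]
    refine ⟨l / t, ⟨div_nonneg hl.1 ht.1.le, ?_⟩, ?_⟩
    · rw [Metric.mem_ball, dist_eq_norm, he', norm_smul, dist_eq_norm, Real.norm_eq_abs,
        abs_of_nonneg (div_nonneg hl.1 ht.1.le)] at hq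
      rw [dist_eq_norm] at hd
      nlinarith
    · simp only [← he']; abel

theorem segment (a b p : Plane) : RadialAt (segment ℝ a b) p := by
  by_cases hp : p ∈ _root_.segment ℝ a b
  · rw [← segment_union_segment_of_mem hp]
    exact (segment_left p a).union (segment_left p b)
  · exact of_notMem (isClosed_segment a b) hp

end RadialAt

theorem IsPolygonalArc.radialAt {S : Set Plane} {p q : Plane} (hA : IsPolygonalArc S p q)
    (z : Plane) : RadialAt S z := by
  obtain ⟨n, x, -, -, -, rfl, -⟩ := isPolygonalArc_iff.mp hA
  exact RadialAt.biUnion (finite_Iio n) fun _ _ => RadialAt.segment _ _ _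

/-- If `q` is a point of the component close to `p`, a point of `C` strictly after `p` on the
segment to `q` would force `q ∈ C`. This is what `RadialAt` is for: a mere closure point becomes the
end of a segment. -/
theorem exists_segment_subset_component {C : Set Plane} {p z : Plane} (hC : RadialAt C p)
    (hp : p ∈ closure (connectedComponentIn Cᶜ z)) :
    ∃ q ∈ connectedComponentIn Cᶜ z,
      AffineMap.lineMap p q '' Ioc (0 : ℝ) 1 ⊆ connectedComponentIn Cᶜ z := by
  obtain ⟨q, hq, hqF⟩ := mem_closure_iff_nhds.mp hp _ hC
  refine ⟨q, hqF, subset_connectedComponentIn_of_mem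
    (isPreconnected_Ioc.image _ AffineMap.lineMap_continuous.continuousOn) ?_
    ⟨1, ⟨one_pos, le_rfl⟩, AffineMap.lineMap_apply_one _ _⟩ hqF⟩
  rintro _ ⟨t, ht, rfl⟩ hm
  exact connectedComponentIn_subset _ _ hqF (hq t ht hm)

theorem segment_eq_insert_image (p q : Plane) :
    segment ℝ p q = insert p (AffineMap.lineMap p q '' Ioc (0 : ℝ) 1) := by
  rw [segment_eq_image_lineMap, ← Ioc_insert_left zero_le_one, image_insert_eq,
    AffineMap.lineMap_apply_zero]

/-- A component of the complement that reaches an inner point of an arc reaches both ends. -/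
theorem IsPolygonalArc.ends_mem_closure {A C : Set Plane} {p q z : Plane}
    (hA : IsPolygonalArc A p q)
    (hC : ∀ w ∈ A \ {p, q}, ∀ᶠ w' in 𝓝 w, (w' ∈ C ↔ w' ∈ A))
    (hne : ((A \ {p, q}) ∩ closure (connectedComponentIn Cᶜ z)).Nonempty) :
    p ∈ closure (connectedComponentIn Cᶜ z) ∧ q ∈ closure (connectedComponentIn Cᶜ z) := by
  set F := connectedComponentIn Cᶜ z
  set s := A \ {p, q}
  -- At an inner point the arc looks like two spokes, so the part of `s` in `closure F` is open in
  -- `s` as well as closed; connectedness of `s` does the rest.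
  have hloc : ∀ w ∈ s, w ∈ closure F → ∀ᶠ w' in 𝓝 w, w' ∈ s → w' ∈ closure F := by
    intro w hw hwF
    have hw' : w ≠ p ∧ w ≠ q := by simpa using hw.2
    obtain ⟨s₁, s₂, h1, h2, h12, h⟩ := hA.eventually_iff_two_segments hw.1 hw'.1 hw'.2
    have := eventually_mem_closure_of_two_segments h1 h2 h12
      ((hC w hw).and h |>.mono fun _ h => h.1.trans h.2) hwF
    filter_upwards [this, hC w hw] with w' a b c
    exact a (b.mpr c.1)
  have hs : s ⊆ closure F := by
    by_contra hns
    obtain ⟨w, hw, hwF⟩ := not_subset.mp hns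
    have := hA.isPreconnected_diff_ends {w | ∀ᶠ w' in 𝓝 w, w' ∈ s → w' ∈ closure F}
      (closure F)ᶜ (isOpen_iff_eventually.mpr fun w hw => eventually_eventually_nhds.mpr hw)
      isClosed_closure.isOpen_compl
      (fun w hw => (em (w ∈ closure F)).imp (hloc w hw) id)
      (hne.mono fun w hw => ⟨hw.1, hloc w hw.1 hw.2⟩) ⟨w, hw, hwF⟩
    obtain ⟨u, hus, hu1, hu2⟩ := this
    exact hu2 (hu1.self_of_nhds hus)
  have hs' := closure_minimal hs isClosed_closure
  refine ⟨hs' hA.left_mem_closure_diff_ends, hs' ?_⟩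
  have := hA.symm.left_mem_closure_diff_ends
  rwa [pair_comm] at this

/-! ### Cutting and extending arcs; arcs through a face -/

theorem IsSimpleChain.mono {n m : ℕ} {x : ℕ → Plane} (h : IsSimpleChain n x) (hmn : m ≤ n) :
    IsSimpleChain m x where
  ne i hi := h.ne i (by omega)
  inter i hi := h.inter i (by omega)
  disjoint i j hij hj := h.disjoint i j hij (by omega)

theorem IsSimpleChain.exists_append {n : ℕ} {x : ℕ → Plane} {v : Plane} (h : IsSimpleChain n x)
    (hv : x n ≠ v) (hi : chainSupport n x ∩ segment ℝ (x n) v ⊆ {x n}) :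
    IsPolygonalArc (chainSupport n x ∪ segment ℝ (x n) v) (x 0) v := by
  rw [isPolygonalArc_iff]
  set y : ℕ → Plane := fun i => if i ≤ n then x i else v
  have hy : ∀ i ≤ n, y i = x i := fun i hi => if_pos hi
  have hyn : y (n + 1) = v := if_neg (by omega)
  have hmem : ∀ {i z}, i < n → z ∈ segment ℝ (x i) (x (i + 1)) → z ∈ segment ℝ (x n) v →
      z = x n := fun hin h1 h2 => hi ⟨mem_chainSupport.mpr ⟨_, hin, h1⟩, h2⟩
  refine ⟨n + 1, y, by omega, hy 0 (by omega), hyn, ?_, ⟨fun i hin => ?_, fun i hin => ?_,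
    fun i j hij hj => ?_⟩⟩
  · ext z
    rw [mem_union, mem_chainSupport, mem_chainSupport]
    constructor
    · rintro (⟨i, hin, hz⟩ | hz)
      · exact ⟨i, by omega, by rwa [hy i (by omega), hy (i + 1) (by omega)]⟩
      · exact ⟨n, by omega, by rwa [hy n le_rfl, hyn]⟩
    · rintro ⟨i, hin, hz⟩
      rcases Nat.lt_succ_iff_lt_or_eq.mp hin with h1 | rfl
      · rw [hy i (by omega), hy (i + 1) (by omega)] at hz
        exact Or.inl ⟨i, h1, hz⟩
      · rw [hy i le_rfl, hyn] at hz
        exact Or.inr hz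
  · rcases Nat.lt_succ_iff_lt_or_eq.mp hin with h1 | rfl
    · rw [hy i (by omega), hy (i + 1) (by omega)]; exact h.ne i h1
    · rwa [hy i le_rfl, hyn]
  · rw [hy i (by omega), hy (i + 1) (by omega)]
    rcases Nat.lt_or_ge (i + 1) n with h1 | h1
    · rw [hy (i + 2) (by omega)]; exact h.inter i h1
    · obtain rfl : n = i + 1 := by omega
      rw [hyn]
      refine Subset.antisymm (fun z hz => hmem (by omega) hz.1 hz.2) ?_
      exact singleton_subset_iff.mpr ⟨right_mem_segment _ _ _, left_mem_segment _ _ _⟩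
  · rw [hy i (by omega), hy (i + 1) (by omega), hy j (by omega)]
    rcases Nat.lt_succ_iff_lt_or_eq.mp hj with h1 | rfl
    · rw [hy (j + 1) (by omega)]; exact h.disjoint i j hij h1
    · rw [hyn, disjoint_left]
      intro z hz1 hz2
      obtain rfl := hmem (by omega) hz1 hz2
      rcases h.eq_or_of_mem (by omega) le_rfl hz1 with h3 | h3 <;> omega

theorem isPolygonalArc_segment {p q : Plane} (h : p ≠ q) : IsPolygonalArc (segment ℝ p q) p q := by
  have h0 : IsSimpleChain 0 (fun _ => p) :=
    ⟨fun i hi => by omega, fun i hi => by omega, fun i j _ hj => by omega⟩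
  have := h0.exists_append h (by simp [chainSupport])
  simpa [chainSupport] using this

namespace IsPolygonalArc

variable {A : Set Plane} {p w : Plane}

theorem exists_truncate (hA : IsPolygonalArc A p w) {z : Plane} (hz : z ∈ A) (hzp : z ≠ p) :
    ∃ B ⊆ A, IsPolygonalArc B p z := by
  classical
  obtain ⟨n, x, -, rfl, -, rfl, h⟩ := isPolygonalArc_iff.mp hA
  have hex := mem_chainSupport.mp hz
  -- The first link through `z` is taken: if `z` is a corner, the later link would leave a
  -- degenerate last segment.
  obtain ⟨i, ⟨hin, hzi⟩, hmin⟩ : ∃ i, (i < n ∧ z ∈ segment ℝ (x i) (x (i + 1))) ∧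
      ∀ j < i, z ∉ segment ℝ (x j) (x (j + 1)) :=
    ⟨Nat.find hex, Nat.find_spec hex, fun j hj hm => Nat.find_min hex hj
      ⟨hj.trans (Nat.find_spec hex).1, hm⟩⟩
  have hxz : x i ≠ z := by
    rintro rfl
    rcases Nat.eq_zero_or_pos i with h0 | h0
    · rw [h0] at hzp; exact hzp rfl
    · refine hmin (i - 1) (by omega) ?_
      rw [show i - 1 + 1 = i by omega]
      exact right_mem_segment _ _ _
  have hsub : segment ℝ (x i) z ⊆ segment ℝ (x i) (x (i + 1)) :=
    (convex_segment _ _).segment_subset (left_mem_segment _ _ _) hzi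
  refine ⟨_, ?_, (h.mono hin.le).exists_append hxz ?_⟩
  · rintro u (hu | hu)
    · obtain ⟨j, hj, hu⟩ := mem_chainSupport.mp hu
      exact mem_chainSupport.mpr ⟨j, by omega, hu⟩
    · exact mem_chainSupport.mpr ⟨i, hin, hsub hu⟩
  · rintro u ⟨hu, hu'⟩
    obtain ⟨j, hj, hu⟩ := mem_chainSupport.mp hu
    exact (h.eq_of_mem_of_mem hj hin hu (hsub hu')).2

theorem append_segment (hA : IsPolygonalArc A p w) {v : Plane} (hv : w ≠ v)
    (hi : A ∩ segment ℝ w v ⊆ {w}) : IsPolygonalArc (A ∪ segment ℝ w v) p v := by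
  obtain ⟨n, x, -, rfl, rfl, rfl, h⟩ := isPolygonalArc_iff.mp hA
  exact h.exists_append hv hi

/-- Loops are avoided by leaving `A` at its point on the segment nearest to `v`: beyond that point
the segment no longer meets `A`. -/
theorem exists_extend (hA : IsPolygonalArc A p w) {v : Plane} (hv : v ≠ p) :
    ∃ B ⊆ A ∪ segment ℝ w v, IsPolygonalArc B p v := by
  obtain ⟨z, ⟨hzA, hzs⟩, hmin⟩ := (hA.isCompact.inter (isCompact_segment w v)).exists_isMinOn
    ⟨w, hA.symm.left_mem, left_mem_segment _ _ _⟩ (f := fun u => dist u v) (by fun_prop)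
  have hsub : segment ℝ z v ⊆ segment ℝ w v :=
    (convex_segment _ _).segment_subset hzs (right_mem_segment _ _ _)
  by_cases hzp : z = p
  · subst hzp
    exact ⟨_, hsub.trans subset_union_right, isPolygonalArc_segment hv.symm⟩
  obtain ⟨B, hBA, hB⟩ := hA.exists_truncate hzA hzp
  by_cases hzv : z = v
  · subst hzv
    exact ⟨B, hBA.trans subset_union_left, hB⟩
  refine ⟨_, union_subset_union hBA hsub, hB.append_segment hzv ?_⟩
  rintro u ⟨hu1, hu2⟩
  have h1 : dist z v ≤ dist u v := hmin ⟨hBA hu1, hsub hu2⟩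
  have h2 := dist_add_dist_of_mem_segment hu2
  have : dist z u ≤ 0 := by linarith
  exact (dist_le_zero.mp this).symm

theorem exists_of_reflTransGen {S : Set Plane} {q : Plane}
    (h : Relation.ReflTransGen (fun a b => segment ℝ a b ⊆ S) p q) (hpq : q ≠ p) :
    ∃ B ⊆ S, IsPolygonalArc B p q := by
  induction h with
  | refl => exact absurd rfl hpq
  | @tail b c hab hbc ih =>
    by_cases hb : b = p
    · subst hb
      exact ⟨_, hbc, isPolygonalArc_segment hpq.symm⟩
    · obtain ⟨B, hBS, hB⟩ := ih hb
      obtain ⟨B', hB', h'⟩ := hB.exists_extend hpq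
      exact ⟨B', hB'.trans (union_subset hBS hbc), h'⟩

end IsPolygonalArc

theorem reflTransGen_of_isPreconnected {F : Set Plane} (hF : IsOpen F) (hF' : IsPreconnected F)
    {p q : Plane} (hp : p ∈ F) (hq : q ∈ F) :
    Relation.ReflTransGen (fun a b => segment ℝ a b ⊆ F) p q := by
  set T := {w | Relation.ReflTransGen (fun a b => segment ℝ a b ⊆ F) p w}
  by_contra hn
  have hloc : ∀ w ∈ F, ∃ r > 0, ∀ w' ∈ Metric.ball w r, w' ∈ F ∧ segment ℝ w w' ⊆ F := by
    intro w hw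
    obtain ⟨r, hr, h⟩ := Metric.isOpen_iff.mp hF w hw
    exact ⟨r, hr, fun w' hw' => ⟨h hw', ((convex_ball w r).segment_subset
      (Metric.mem_ball_self hr) hw').trans h⟩⟩
  have h1 : IsOpen (F ∩ T) := by
    refine Metric.isOpen_iff.mpr fun w hw => ?_
    obtain ⟨r, hr, h⟩ := hloc w hw.1
    exact ⟨r, hr, fun w' hw' => ⟨(h w' hw').1, Relation.ReflTransGen.tail hw.2 (h w' hw').2⟩⟩
  have h2 : IsOpen (F ∩ Tᶜ) := by
    refine Metric.isOpen_iff.mpr fun w hw => ?_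
    obtain ⟨r, hr, h⟩ := hloc w hw.1
    refine ⟨r, hr, fun w' hw' => ⟨(h w' hw').1, fun hT => hw.2 ?_⟩⟩
    refine Relation.ReflTransGen.tail hT ?_
    rw [segment_symm]
    exact (h w' hw').2
  obtain ⟨u, -, hu1, hu2⟩ := hF' _ _ h1 h2
    (fun w hw => (em (w ∈ T)).imp (fun h => ⟨hw, h⟩) fun h => ⟨hw, h⟩)
    ⟨p, hp, hp, Relation.ReflTransGen.refl⟩ ⟨q, hq, hq, hn⟩
  exact hu2.2 hu1.2

/-- Two boundary points of a component of the complement of `C` are joined by a polygonal arc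
through this component. -/
theorem exists_isPolygonalArc_of_mem_closure {C : Set Plane} {p q z : Plane} (hC : IsClosed C)
    (hpq : p ≠ q) (hCp : RadialAt C p) (hCq : RadialAt C q)
    (hp : p ∈ closure (connectedComponentIn Cᶜ z)) (hq : q ∈ closure (connectedComponentIn Cᶜ z)) :
    ∃ A, IsPolygonalArc A p q ∧ A ∩ C ⊆ {p, q} := by
  obtain ⟨p', hp', hpp'⟩ := exists_segment_subset_component hCp hp
  obtain ⟨q', hq', hqq'⟩ := exists_segment_subset_component hCq hq
  set F := connectedComponentIn Cᶜ z
  -- A possibly self-crossing chain: straight from `p` into the face, across it, and straight out to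
  -- `q`. It is made simple afterwards.
  have hw : Relation.ReflTransGen (fun a b => segment ℝ a b ⊆ F ∪ {p, q}) p q := by
    refine Relation.ReflTransGen.head (b := p') ?_ (Relation.ReflTransGen.tail (b := q') ?_ ?_)
    · rw [segment_eq_insert_image]
      exact insert_subset (by simp) (hpp'.trans subset_union_left)
    · exact Relation.ReflTransGen.mono (fun a b h => Subset.trans h subset_union_left) _ _
        (reflTransGen_of_isPreconnected hC.isOpen_compl.connectedComponentIn
          isPreconnected_connectedComponentIn hp' hq')
    · rw [segment_symm, segment_eq_insert_image]
      exact insert_subset (by simp) (hqq'.trans subset_union_left)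
  obtain ⟨A, hA, hA'⟩ := IsPolygonalArc.exists_of_reflTransGen hw hpq.symm
  refine ⟨A, hA', ?_⟩
  rintro u ⟨huA, huC⟩
  exact (hA huA).resolve_left fun h => connectedComponentIn_subset _ _ h huC

/-! ### Faces of plane drawings and insertion of edges -/

namespace SimpleGraph.PlaneDrawing

variable {V : Type*} {G : SimpleGraph V} (D : G.PlaneDrawing)

theorem isPolygonalArc_of_mem {e : Sym2 V} (he : e ∈ G.edgeSet) :
    ∃ p q, IsPolygonalArc (D.arc e) p q := by
  induction e with
  | _ u v => exact ⟨_, _, D.isPolygonalArc u v he⟩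

theorem arc_subset_carrier {e : Sym2 V} (he : e ∈ G.edgeSet) : D.arc e ⊆ D.carrier :=
  fun _ h => Or.inr (mem_biUnion he h)

theorem pos_mem_carrier (v : V) : D.pos v ∈ D.carrier := Or.inl (mem_range_self v)

theorem segment_inter_segment_of_adj {y a b : V} (ha : G.Adj y a) (hb : G.Adj y b) (hab : a ≠ b)
    {s t : Plane} (hs : segment ℝ (D.pos y) s ⊆ D.arc s(y, a))
    (ht : segment ℝ (D.pos y) t ⊆ D.arc s(y, b)) :
    segment ℝ (D.pos y) s ∩ segment ℝ (D.pos y) t ⊆ {D.pos y} := by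
  rintro p ⟨h1, h2⟩
  obtain ⟨w, ⟨hw1, hw2⟩, rfl⟩ := D.arc_inter_arc _ ha _ hb
    (fun h => hab (Sym2.congr_right.mp h)) ⟨hs h1, ht h2⟩
  simp only [Sym2.mem_iff] at hw1 hw2
  have : w = y := by
    rcases hw1 with h | rfl
    · exact h
    · exact hw2.resolve_right hab
  rw [this, mem_singleton_iff]

section Finite

variable [Finite V]

theorem isCompact_carrier : IsCompact D.carrier := by
  refine (finite_range D.pos).isCompact.union (G.edgeSet.toFinite.isCompact_biUnion fun e he => ?_)
  obtain ⟨p, q, h⟩ := D.isPolygonalArc_of_mem he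
  exact h.isCompact

theorem radialAt_carrier (p : Plane) : RadialAt D.carrier p := by
  refine RadialAt.union ?_ (RadialAt.biUnion G.edgeSet.toFinite fun e he => ?_)
  · rw [← iUnion_singleton_eq_range, ← biUnion_univ]
    refine RadialAt.biUnion finite_univ fun v _ => ?_
    rw [← segment_same ℝ]
    exact RadialAt.segment _ _ _
  · obtain ⟨_, _, h⟩ := D.isPolygonalArc_of_mem he
    exact h.radialAt p

theorem eventually_mem_carrier_union {K : Set Plane} (hK : IsClosed K) {p : Plane} (hp : p ∉ K) :
    ∀ᶠ w in 𝓝 p, w ∈ D.carrier ∪ K → w = p ∧ p ∈ range D.pos ∨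
      ∃ e ∈ G.edgeSet, w ∈ D.arc e ∧ p ∈ D.arc e := by
  have h1 := ((finite_range D.pos).subset (t := range D.pos \ {p})
    sdiff_subset).isClosed.isOpen_compl.mem_nhds (x := p) (by simp)
  have h2 := eventually_forall_mem_imp G.edgeSet.toFinite (A := D.arc)
    (fun e he => (D.isPolygonalArc_of_mem he).elim fun _ h => h.elim fun _ h => h.isCompact.isClosed) p
  filter_upwards [h1, h2, hK.isOpen_compl.mem_nhds hp] with w a b c h
  rcases h with (h | h) | h
  · have : w = p := by
      by_contra hne
      exact a ⟨h, hne⟩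
    subst this
    exact Or.inl ⟨rfl, h⟩
  · obtain ⟨e, he, h⟩ := mem_iUnion₂.mp h
    exact Or.inr ⟨e, he, h, b e he h⟩
  · exact absurd h c

/-- Inner points of an edge are not vertices, so they have positive distance from `K` and from all
other edges. This is the local hypothesis of `IsPolygonalArc.ends_mem_closure`. -/
theorem eventually_mem_iff_mem_arc {K : Set Plane} (hK : IsClosed K)
    (hKD : K ∩ D.carrier ⊆ range D.pos) {u v : V} (huv : G.Adj u v) :
    ∀ p ∈ D.arc s(u, v) \ {D.pos u, D.pos v},
      ∀ᶠ w in 𝓝 p, (w ∈ D.carrier ∪ K ↔ w ∈ D.arc s(u, v)) := by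
  rintro p ⟨hp, hp'⟩
  have hr : p ∉ range D.pos := by
    rintro ⟨x, rfl⟩
    have := D.vertex_on_arc _ huv x hp
    rcases Sym2.mem_iff.mp this with rfl | rfl
    · exact hp' (Or.inl rfl)
    · exact hp' (Or.inr rfl)
  have hpK : p ∉ K := fun h => hr (hKD ⟨h, D.arc_subset_carrier huv hp⟩)
  filter_upwards [D.eventually_mem_carrier_union hK hpK] with w h
  refine ⟨fun hw => ?_, fun hw => Or.inl (D.arc_subset_carrier huv hw)⟩
  rcases h hw with ⟨-, h⟩ | ⟨e, he, h1, h2⟩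
  · exact absurd h hr
  · by_cases hne : e = s(u, v)
    · rwa [← hne]
    · obtain ⟨x, -, hx⟩ := D.arc_inter_arc _ he _ huv hne ⟨h2, hp⟩
      exact absurd ⟨x, hx⟩ hr

/-- Two neighbours of a vertex of degree at most three lie on the boundary of a common face. -/
theorem exists_common_face {K : Set Plane} (hK : IsClosed K)
    (hKD : K ∩ D.carrier ⊆ range D.pos) {y a b c : V} (hy : D.pos y ∉ K) (ha : G.Adj y a)
    (hb : G.Adj y b) (hab : a ≠ b) (hdeg : ∀ w, G.Adj y w → w = a ∨ w = b ∨ w = c) :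
    ∃ z, D.pos a ∈ closure (connectedComponentIn (D.carrier ∪ K)ᶜ z) ∧
      D.pos b ∈ closure (connectedComponentIn (D.carrier ∪ K)ᶜ z) := by
  obtain ⟨s, hs, hsA, hsn⟩ := (D.isPolygonalArc y a ha).eventually_eq_segment
  obtain ⟨t, ht, htA, htn⟩ := (D.isPolygonalArc y b hb).eventually_eq_segment
  have hst := D.segment_inter_segment_of_adj ha hb hab hsA htA
  have key : ∃ z, ∀ᶠ q in 𝓝 (D.pos y), q ∈ segment ℝ (D.pos y) s ∪ segment ℝ (D.pos y) t →
      q ∈ closure (connectedComponentIn (D.carrier ∪ K)ᶜ z) := by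
    have hloc : ∀ᶠ w in 𝓝 (D.pos y), w ∈ D.carrier ∪ K →
        w = D.pos y ∨ ∃ x, G.Adj y x ∧ w ∈ D.arc s(y, x) := by
      filter_upwards [D.eventually_mem_carrier_union hK hy] with w h hw
      rcases h hw with ⟨h, -⟩ | ⟨e, he, h1, h2⟩
      · exact Or.inl h
      · obtain ⟨x, rfl⟩ := Sym2.mem_iff_exists.mp (D.vertex_on_arc e he y h2)
        exact Or.inr ⟨x, he, h1⟩
    -- The vertex `c` is only a bound on the possible neighbours; it may coincide with `a` or `b`,
    -- or not be adjacent to `y`.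
    by_cases hc : G.Adj y c ∧ c ≠ a ∧ c ≠ b
    · obtain ⟨r, hr, hrA, hrn⟩ := (D.isPolygonalArc y c hc.1).eventually_eq_segment
      refine exists_component_of_three_segments hs ht hr hst
        (D.segment_inter_segment_of_adj ha hc.1 hc.2.1.symm hsA hrA)
        (D.segment_inter_segment_of_adj hb hc.1 hc.2.2.symm htA hrA) ?_
      filter_upwards [hloc, hsn, htn, hrn] with w h h1 h2 h3 hw
      rcases h hw with rfl | ⟨x, hx, hwx⟩
      · exact Or.inl (Or.inl (left_mem_segment _ _ _))
      · rcases hdeg x hx with rfl | rfl | rfl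
        · exact Or.inl (Or.inl (h1 hwx))
        · exact Or.inl (Or.inr (h2 hwx))
        · exact Or.inr (h3 hwx)
    · refine exists_component_of_two_segments hs ht hst ?_
      filter_upwards [hloc, hsn, htn] with w h h1 h2 hw
      rcases h hw with rfl | ⟨x, hx, hwx⟩
      · exact Or.inl (left_mem_segment _ _ _)
      · have hx' : x = a ∨ x = b := by
          rcases hdeg x hx with h | h | rfl
          · exact Or.inl h
          · exact Or.inr h
          · by_contra! hne
            exact hc ⟨hx, hne⟩
        rcases hx' with rfl | rfl
        · exact Or.inl (h1 hwx)
        · exact Or.inr (h2 hwx)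
  obtain ⟨z, hz⟩ := key
  refine ⟨z, ?_, ?_⟩
  -- A point of the edge close to `y` lies in the closure of the face; propagation along the edge
  -- carries this to its far end.
  · refine ((D.isPolygonalArc y a ha).ends_mem_closure
      (D.eventually_mem_iff_mem_arc hK hKD ha) ?_).2
    obtain ⟨w, ⟨h1, h2⟩, hw⟩ := mem_closure_iff_nhds.mp
      (D.isPolygonalArc y a ha).left_mem_closure_diff_ends _ (hz.and hsn)
    exact ⟨w, hw, h1 (Or.inl (h2 hw.1))⟩
  · refine ((D.isPolygonalArc y b hb).ends_mem_closure
      (D.eventually_mem_iff_mem_arc hK hKD hb) ?_).2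
    obtain ⟨w, ⟨h1, h2⟩, hw⟩ := mem_closure_iff_nhds.mp
      (D.isPolygonalArc y b hb).left_mem_closure_diff_ends _ (hz.and htn)
    exact ⟨w, hw, h1 (Or.inr (h2 hw.1))⟩

end Finite

/-- Draw an additional edge along a given arc. -/
theorem exists_sup_edge {a b : V} (hab : a ≠ b) (hadj : ¬ G.Adj a b) {A : Set Plane}
    (hA : IsPolygonalArc A (D.pos a) (D.pos b))
    (hAD : A ∩ D.carrier ⊆ {D.pos a, D.pos b}) :
    ∃ D' : (G ⊔ edge a b).PlaneDrawing, D'.pos = D.pos ∧ D'.carrier ⊆ D.carrier ∪ A := by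
  classical
  have hedge : ∀ e ∈ (G ⊔ edge a b).edgeSet, e ≠ s(a, b) → e ∈ G.edgeSet := by
    intro e he hne
    rw [edgeSet_sup, edgeSet_edge_of_ne hab] at he
    exact he.resolve_right hne
  have hmemA : ∀ w, D.pos w ∈ A → w ∈ s(a, b) := by
    intro w hw
    rw [Sym2.mem_iff]
    exact (hAD ⟨hw, D.pos_mem_carrier w⟩).imp (fun h => D.pos_injective h)
      fun h => D.pos_injective h
  have hinter : ∀ e ∈ G.edgeSet, A ∩ D.arc e ⊆ D.pos '' {w | w ∈ s(a, b) ∧ w ∈ e} := by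
    rintro e he p ⟨hpA, hpe⟩
    rcases hAD ⟨hpA, D.arc_subset_carrier he hpe⟩ with rfl | rfl
    · exact ⟨a, ⟨Sym2.mem_mk_left a b, D.vertex_on_arc e he _ hpe⟩, rfl⟩
    · exact ⟨b, ⟨Sym2.mem_mk_right a b, D.vertex_on_arc e he _ hpe⟩, rfl⟩
  refine ⟨{ pos := D.pos
            arc := fun e => if e = s(a, b) then A else D.arc e
            pos_injective := D.pos_injective
            isPolygonalArc := ?_
            vertex_on_arc := ?_
            arc_inter_arc := ?_ }, rfl, ?_⟩
  · intro u v huv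
    split_ifs with h
    · rcases Sym2.eq_iff.mp h with ⟨rfl, rfl⟩ | ⟨rfl, rfl⟩
      · exact hA
      · exact hA.symm
    · exact D.isPolygonalArc u v (hedge _ huv h)
  · intro e he w hw
    split_ifs at hw with h
    · rw [h]; exact hmemA w hw
    · exact D.vertex_on_arc e (hedge e he h) w hw
  · intro e he f hf hne
    split_ifs with h1 h2 h2
    · exact absurd (h1.trans h2.symm) hne
    · rw [h1]; exact hinter f (hedge f hf h2)
    · rw [h2, inter_comm]
      exact (hinter e (hedge e he h1)).trans (image_mono fun w hw => ⟨hw.2, hw.1⟩)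
    · exact D.arc_inter_arc e (hedge e he h1) f (hedge f hf h2) hne
  · rintro p (hp | hp)
    · exact Or.inl (Or.inl hp)
    · obtain ⟨e, he, hp⟩ := mem_iUnion₂.mp hp
      change p ∈ (if e = s(a, b) then A else D.arc e) at hp
      split_ifs at hp with h
      · exact Or.inr hp
      · exact Or.inl (D.arc_subset_carrier (hedge e he h) hp)

/-- The drawing of a subgraph. -/
def comap {W : Type*} {H : SimpleGraph W} (f : H →g G) (hf : Function.Injective f) :
    H.PlaneDrawing where
  pos := D.pos ∘ f
  arc e := D.arc (e.map f)
  pos_injective := D.pos_injective.comp hf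
  isPolygonalArc u v h := D.isPolygonalArc (f u) (f v) (f.map_adj h)
  vertex_on_arc e he w hw := by
    obtain ⟨w', h, h'⟩ := Sym2.mem_map.mp (D.vertex_on_arc _ (f.map_mem_edgeSet he) _ hw)
    rwa [← hf h']
  arc_inter_arc e he g hg hne p hp := by
    obtain ⟨v, ⟨hv1, hv2⟩, rfl⟩ := D.arc_inter_arc _ (f.map_mem_edgeSet he) _
      (f.map_mem_edgeSet hg) (fun h => hne (Sym2.map.injective hf h)) hp
    obtain ⟨w, hw, rfl⟩ := Sym2.mem_map.mp hv1
    obtain ⟨w', hw', h'⟩ := Sym2.mem_map.mp hv2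
    exact ⟨w, ⟨hw, hf h' ▸ hw'⟩, rfl⟩

theorem comap_carrier_subset {W : Type*} {H : SimpleGraph W} (f : H →g G)
    (hf : Function.Injective f) : (D.comap f hf).carrier ⊆ D.carrier := by
  rintro p (⟨w, rfl⟩ | hp)
  · exact D.pos_mem_carrier (f w)
  · obtain ⟨e, he, hp⟩ := mem_iUnion₂.mp hp
    exact D.arc_subset_carrier (f.map_mem_edgeSet he) hp

end SimpleGraph.PlaneDrawing

/-! ### The exact square of a bipartite graph -/

theorem Set.exists_forall_eq_or_of_encard_le_three {α : Type*} {s : Set α} (hs : s.encard ≤ 3)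
    {a b : α} (ha : a ∈ s) (hb : b ∈ s) (hab : a ≠ b) :
    ∃ c, ∀ w ∈ s, w = a ∨ w = b ∨ w = c := by
  by_contra! h
  -- The repeated candidate `a` yields a third element; using that one as candidate yields a fourth.
  obtain ⟨c, hc, hca, hcb, -⟩ := h a
  obtain ⟨d, hd, hda, hdb, hdc⟩ := h c
  have hsub : ({d, c, a, b} : Set α) ⊆ s := by
    rintro w (rfl | rfl | rfl | rfl) <;> assumption
  have h4 : ({d, c, a, b} : Set α).encard = 4 := by
    rw [encard_insert_of_notMem (by simp [hdc, hda, hdb]),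
      encard_insert_of_notMem (by simp [hca, hcb]), encard_pair hab]
    norm_num
  have := (encard_le_encard hsub).trans hs
  rw [h4] at this
  exact absurd this (by decide)

namespace SimpleGraph

variable {V : Type*} {G : SimpleGraph V}

theorem exists_adj_adj_of_exactSquare_adj {u v : V} (h : G.exactSquare.Adj u v) :
    u ≠ v ∧ ∃ y, G.Adj u y ∧ G.Adj y v := by
  refine ⟨h.ne, ?_⟩
  have h2 : G.dist u v = 2 := h
  obtain ⟨p, hp⟩ := exists_walk_of_dist_ne_zero (G := G) (u := u) (v := v) (by omega)
  rw [h2] at hp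
  cases p with
  | nil => simp at hp
  | cons h1 p =>
    cases p with
    | nil => simp at hp
    | cons h3 p =>
      cases p with
      | nil => exact ⟨_, h1, h3⟩
      | cons _ p => simp at hp

/-- Distance one is excluded because `u` and `v` lie in the same part. -/
theorem IsBipartiteWith.exactSquare_adj {X Y : Set V} (hXY : G.IsBipartiteWith X Y) {u v y : V}
    (hu : u ∈ X) (huv : u ≠ v) (huy : G.Adj u y) (hyv : G.Adj y v) : G.exactSquare.Adj u v := by
  change G.dist u v = 2
  have hy : y ∈ Y := hXY.mem_of_mem_adj hu huy
  have hv : v ∈ X := hXY.symm.mem_of_mem_adj hy hyv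
  have h1 : G.dist u v ≤ 2 := dist_le (Walk.cons huy (Walk.cons hyv Walk.nil))
  have h2 : G.dist u v ≠ 0 := fun h =>
    huv ((huy.reachable.trans hyv.reachable).dist_eq_zero_iff.mp h)
  have h3 : G.dist u v ≠ 1 := fun h =>
    Set.disjoint_left.mp hXY.disjoint hv (hXY.mem_of_mem_adj hu (dist_eq_one_iff_adj.mp h))
  omega

theorem IsBipartiteWith.exactSquare_reachable {X Y : Set V} (hXY : G.IsBipartiteWith X Y) :
    ∀ (n : ℕ) {u v : V} (p : G.Walk u v), p.length ≤ n → u ∈ X → v ∈ X →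
      G.exactSquare.Reachable u v := by
  intro n
  induction n with
  | zero =>
    intro u v p hp hu hv
    rw [Walk.eq_of_length_eq_zero (Nat.le_zero.mp hp)]
  | succ n ih =>
    intro u v p hp hu hv
    cases p with
    | nil => exact Reachable.refl _
    | cons h1 p =>
      have hy := hXY.mem_of_mem_adj hu h1
      cases p with
      | nil => exact absurd hy (Set.disjoint_left.mp hXY.disjoint hv)
      | @cons _ w _ h2 p =>
        simp only [Walk.length_cons] at hp
        have hr := ih p (by omega) (hXY.symm.mem_of_mem_adj hy h2) hv
        by_cases huw : u = w
        · rwa [huw]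
        · exact (hXY.exactSquare_adj hu huw h1 h2).reachable.trans hr

theorem IsBipartiteWith.supp_connectedComponentMk {X Y : Set V} (hXY : G.IsBipartiteWith X Y)
    (hconn : G.Connected) {x : V} (hx : x ∈ X) :
    (G.exactSquare.connectedComponentMk x).supp = X := by
  ext v
  rw [ConnectedComponent.mem_supp_iff, ConnectedComponent.eq]
  constructor
  · intro h
    obtain ⟨p⟩ := h.symm
    clear h
    induction p with
    | nil => exact hx
    | cons h p ih =>
      obtain ⟨-, y, h1, h2⟩ := exists_adj_adj_of_exactSquare_adj h
      exact ih (hXY.symm.mem_of_mem_adj (hXY.mem_of_mem_adj hx h1) h2)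
  · intro hv
    obtain ⟨p⟩ := hconn.preconnected v x
    exact hXY.exactSquare_reachable _ p le_rfl hv hx

/-! ### Drawing the exact square on one part, with a barrier -/

theorem PlaneDrawing.exists_square [Finite V] (D : G.PlaneDrawing) (hsub : G.IsSubcubic)
    {X Y : Set V} (hXY : G.IsBipartiteWith X Y) {K : Set Plane} (hK : IsClosed K)
    (hKD : K ∩ D.carrier ⊆ D.pos '' X) (hKr : ∀ x ∈ X, RadialAt K (D.pos x)) :
    ∃ (H : SimpleGraph V) (D' : H.PlaneDrawing), D'.pos = D.pos ∧
      K ∩ D'.carrier ⊆ D.pos '' X ∧ ∀ u ∈ X, ∀ v ∈ X, G.exactSquare.Adj u v → H.Adj u v := by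
  -- Maximality replaces an induction over the missing edges. Confining new edges to `X` preserves
  -- the degrees in `Y`, and the condition on `K` keeps the barrier intact.
  obtain ⟨H, ⟨⟨hGH, hHG, D', hpos, hKD'⟩, hmax⟩⟩ := (toFinite {H : SimpleGraph V | G ≤ H ∧
    (∀ u v, H.Adj u v → G.Adj u v ∨ u ∈ X ∧ v ∈ X) ∧ ∃ D' : H.PlaneDrawing, D'.pos = D.pos ∧
      K ∩ D'.carrier ⊆ D.pos '' X}).exists_maximal
    ⟨G, le_rfl, fun u v h => Or.inl h, D, rfl, hKD⟩
  refine ⟨H, D', hpos, hKD', fun u hu v hv huv => ?_⟩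
  by_contra hH
  obtain ⟨hne, y, huy, hyv⟩ := exists_adj_adj_of_exactSquare_adj huv
  have hy : y ∉ X := Set.disjoint_right.mp hXY.disjoint (hXY.mem_of_mem_adj hu huy)
  obtain ⟨c, hc⟩ := Set.exists_forall_eq_or_of_encard_le_three (hsub y) huy.symm hyv hne
  have hyK : D'.pos y ∉ K := by
    intro h
    obtain ⟨x, hx, hxy⟩ := hKD' ⟨h, D'.pos_mem_carrier y⟩
    rw [hpos] at hxy
    exact hy (D.pos_injective hxy ▸ hx)
  obtain ⟨z, hzu, hzv⟩ := D'.exists_common_face hK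
    (hKD'.trans (hpos ▸ image_subset_range _ _)) hyK (hGH huy.symm) (hGH hyv) hne
    fun w hw => hc w ((hHG y w hw).resolve_right fun h => hy h.1)
  obtain ⟨A, hA, hAC⟩ := exists_isPolygonalArc_of_mem_closure
    (D'.isCompact_carrier.isClosed.union hK) (D'.pos_injective.ne hne)
    ((D'.radialAt_carrier _).union (hpos ▸ hKr u hu))
    ((D'.radialAt_carrier _).union (hpos ▸ hKr v hv)) hzu hzv
  obtain ⟨D'', hpos', hcar⟩ := D'.exists_sup_edge hne hH hA
    fun p hp => hAC ⟨hp.1, Or.inl hp.2⟩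
  have hmem := @hmax (H ⊔ edge u v) ⟨hGH.trans le_sup_left, ?_, D'', hpos'.trans hpos, ?_⟩
    le_sup_left
  · exact hH (hmem (Or.inr ((edge_adj ..).mpr ⟨Or.inl ⟨rfl, rfl⟩, hne⟩)))
  · rintro a b (h | h)
    · exact hHG a b h
    · obtain ⟨⟨rfl, rfl⟩ | ⟨rfl, rfl⟩, -⟩ := (edge_adj ..).mp h
      · exact Or.inr ⟨hu, hv⟩
      · exact Or.inr ⟨hv, hu⟩
  · rintro p ⟨hpK, hp⟩
    rcases hcar hp with hp | hp
    · exact hKD' ⟨hpK, hp⟩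
    · rcases hAC ⟨hp, Or.inr hpK⟩ with rfl | rfl
      · exact ⟨u, hu, by rw [hpos]⟩
      · exact ⟨v, hv, by rw [hpos]⟩

/-- A vertex on the boundary of the outer face is joined to infinity by a set that avoids the
drawing. -/
theorem PlaneDrawing.exists_escape [Finite V] (D : G.PlaneDrawing) {v : V}
    (hv : D.pos v ∈ frontier D.outerFace) (R : ℝ) :
    ∃ (q : Plane) (P : Set Plane), IsCompact P ∧ IsPreconnected P ∧ q ∈ P ∧
      (P ∩ (Metric.ball 0 R)ᶜ).Nonempty ∧ P ⊆ D.carrierᶜ ∧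
      AffineMap.lineMap (D.pos v) q '' Ioc (0 : ℝ) 1 ⊆ D.carrierᶜ := by
  obtain ⟨q, hq, hqC, hqu⟩ := mem_closure_iff_nhds.mp (frontier_subset_closure hv) _
    (D.radialAt_carrier (D.pos v))
  set F := connectedComponentIn D.carrierᶜ q with hF
  have hFo : IsOpen F := D.isCompact_carrier.isClosed.isOpen_compl.connectedComponentIn
  obtain ⟨w, hwF, hw⟩ : ∃ w ∈ F, w ∉ Metric.ball (0 : Plane) R :=
    not_subset.mp fun h => hqu (Metric.isBounded_ball.subset h)
  have hqF : q ∈ F := mem_connectedComponentIn hqC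
  have hpc := hFo.isConnected_iff_isPathConnected.mp ⟨⟨q, hqF⟩, isPreconnected_connectedComponentIn⟩
  obtain ⟨γ, hγ⟩ := hpc.joinedIn q hqF w hwF
  refine ⟨q, range γ, isCompact_range γ.continuous, isPreconnected_range γ.continuous,
    ⟨0, γ.source⟩, ⟨w, ⟨1, γ.target⟩, hw⟩, ?_, ?_⟩
  · rintro _ ⟨t, rfl⟩
    exact connectedComponentIn_subset _ _ (hγ t)
  · rintro _ ⟨t, ht, rfl⟩ h
    exact hqC (hq t ht h)

/-- The barrier is the outside of a large disc together with, for each `x ∈ X`, an escape route from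
`x` to it. The routes start with a straight segment, which gives `RadialAt`; the rest is a compact
path off the drawing and need not be polygonal. -/
theorem PlaneDrawing.exists_barrier [Finite V] (D : G.PlaneDrawing)
    (hD : ∀ v, D.pos v ∈ frontier D.outerFace) (X : Set V) :
    ∃ K : Set Plane, IsClosed K ∧ K ∩ D.carrier ⊆ D.pos '' X ∧
      (∀ x ∈ X, RadialAt K (D.pos x)) ∧ ∀ x ∈ X, ∃ T ⊆ K \ D.carrier, IsPreconnected T ∧
        ¬ Bornology.IsBounded T ∧ D.pos x ∈ closure T := by
  obtain ⟨R, hR0, hR⟩ := D.isCompact_carrier.isBounded.subset_ball_lt 0 0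
  choose q P hPc hPp hqP hPR hPD hq using fun v => D.exists_escape (hD v) R
  set W := (Metric.ball (0 : Plane) R)ᶜ
  have hWc : IsClosed W := Metric.isOpen_ball.isClosed_compl
  have hWD : W ⊆ D.carrierᶜ := compl_subset_compl.mpr hR
  have hWu : ¬ Bornology.IsBounded W := fun h =>
    NormedSpace.unbounded_univ ℝ Plane (by
      rw [← union_compl_self (Metric.ball (0 : Plane) R)]
      exact Metric.isBounded_ball.union h)
  refine ⟨W ∪ ⋃ x ∈ X, (segment ℝ (D.pos x) (q x) ∪ P x), ?_, ?_, ?_, ?_⟩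
  · exact hWc.union (X.toFinite.isClosed_biUnion fun x _ =>
      (isClosed_segment _ _).union (hPc x).isClosed)
  · rintro p ⟨hp | hp, hpD⟩
    · exact absurd hpD (hWD hp)
    · obtain ⟨x, hx, hp | hp⟩ := mem_iUnion₂.mp hp
      · rw [segment_eq_insert_image] at hp
        rcases hp with rfl | hp
        · exact ⟨x, hx, rfl⟩
        · exact absurd hpD (hq x hp)
      · exact absurd hpD (hPD x hp)
  · intro x _
    have hx := D.pos_mem_carrier x
    refine (RadialAt.of_notMem hWc fun h => hWD h hx).union (RadialAt.biUnion X.toFinite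
      fun x' _ => (RadialAt.segment _ _ _).union (RadialAt.of_notMem (hPc x').isClosed
        fun h => hPD x' h hx))
  · intro x hx
    set L := AffineMap.lineMap (D.pos x) (q x) '' Ioc (0 : ℝ) 1
    have hLp : IsPreconnected L :=
      isPreconnected_Ioc.image _ AffineMap.lineMap_continuous.continuousOn
    have hqL : q x ∈ L := ⟨1, ⟨one_pos, le_rfl⟩, AffineMap.lineMap_apply_one _ _⟩
    obtain ⟨w, hwP, hwW⟩ := hPR x
    refine ⟨L ∪ P x ∪ W, ?_, ?_, fun h => hWu (h.subset subset_union_right), ?_⟩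
    · rintro p ((hp | hp) | hp)
      · refine ⟨Or.inr (mem_biUnion hx (Or.inl ?_)), hq x hp⟩
        rw [segment_eq_insert_image]
        exact Or.inr hp
      · exact ⟨Or.inr (mem_biUnion hx (Or.inr hp)), hPD x hp⟩
      · exact ⟨Or.inl hp, hWD hp⟩
    · exact (hLp.union (q x) hqL (hqP x) (hPp x)).union w (Or.inr hwP) hwW
        (isPreconnected_compl_ball R hR0)
    · refine closure_mono (subset_union_left.trans subset_union_left) ?_
      have h0 : (0 : ℝ) ∈ closure (Ioc (0 : ℝ) 1) := by
        rw [closure_Ioc zero_ne_one]; exact ⟨le_rfl, zero_le_one⟩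
      have := image_closure_subset_closure_image
        (AffineMap.lineMap_continuous (R := ℝ) (p := D.pos x) (q := q x)) (mem_image_of_mem _ h0)
      rwa [AffineMap.lineMap_apply_zero] at this

theorem PlaneDrawing.mem_frontier_outerFace [Finite V] (D : G.PlaneDrawing) {v : V} {T : Set Plane}
    (hTD : T ⊆ D.carrierᶜ) (hT : IsPreconnected T) (hTu : ¬ Bornology.IsBounded T)
    (hv : D.pos v ∈ closure T) : D.pos v ∈ frontier D.outerFace := by
  refine ⟨closure_mono (fun t ht => ?_) hv,
    fun h => (interior_subset h).1 (D.pos_mem_carrier v)⟩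
  exact ⟨hTD ht, fun hb => hTu (hb.subset (hT.subset_connectedComponentIn ht hTD))⟩

/-! ### Planarity and outerplanarity of the components -/

theorem IsBipartiteWith.isPlanar_toSimpleGraph [Finite V] {X Y : Set V}
    (hXY : G.IsBipartiteWith X Y) (hsub : G.IsSubcubic) {c : G.exactSquare.ConnectedComponent}
    (hc : c.supp = X) : (G.IsPlanar → c.toSimpleGraph.IsPlanar) ∧
      (G.IsOuterplanar → c.toSimpleGraph.IsOuterplanar) := by
  have hX : ∀ v : c, (v : V) ∈ X := fun v => hc ▸ v.2
  have hom : ∀ H : SimpleGraph V, (∀ u ∈ X, ∀ v ∈ X, G.exactSquare.Adj u v → H.Adj u v) →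
      ∃ f : c.toSimpleGraph →g H, ⇑f = Subtype.val := fun H hH =>
    ⟨⟨Subtype.val, fun {u v} h => hH u (hX u) v (hX v) h⟩, rfl⟩
  constructor
  · rintro ⟨D⟩
    obtain ⟨H, D', -, -, hH⟩ := D.exists_square hsub hXY isClosed_empty (by simp)
      fun x _ => RadialAt.empty _
    obtain ⟨f, hf⟩ := hom H hH
    exact ⟨D'.comap f (hf ▸ Subtype.val_injective)⟩
  · rintro ⟨D, hD⟩
    obtain ⟨K, hK, hKD, hKr, hT⟩ := D.exists_barrier hD X
    obtain ⟨H, D', hpos, hKD', hH⟩ := D.exists_square hsub hXY hK hKD hKr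
    obtain ⟨f, hf⟩ := hom H hH
    have hinj : Function.Injective f := hf ▸ Subtype.val_injective
    refine ⟨D'.comap f hinj, fun v => ?_⟩
    obtain ⟨T, hTK, hTp, hTu, hvT⟩ := hT v (hX v)
    -- The new drawing meets `K` only in old vertex positions, and `T` is a part of `K` off the old
    -- drawing, so `T` still leads to infinity.
    refine PlaneDrawing.mem_frontier_outerFace _ (fun p hp h => ?_) hTp hTu ?_
    · obtain ⟨x, -, rfl⟩ := hKD' ⟨(hTK hp).1, D'.comap_carrier_subset f hinj h⟩
      exact (hTK hp).2 (D.pos_mem_carrier x)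
    · change D'.pos (f v) ∈ _
      rwa [hpos, hf]

end SimpleGraph

theorem mainTheorem5 {V : Type*} [Finite V] [Nontrivial V] (G : SimpleGraph V)
    (hconn : G.Connected) (hplanar : G.IsPlanar) (hsub : G.IsSubcubic)
    (X Y : Set V) (hXY : G.IsBipartiteWith X Y) :
    ∃ cX cY : G.exactSquare.ConnectedComponent,
      cX ≠ cY ∧ (∀ c : G.exactSquare.ConnectedComponent, c = cX ∨ c = cY) ∧
      cX.supp = X ∧ cY.supp = Y ∧
      cX.toSimpleGraph.IsPlanar ∧ cY.toSimpleGraph.IsPlanar ∧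
      (G.IsOuterplanar → cX.toSimpleGraph.IsOuterplanar ∧ cY.toSimpleGraph.IsOuterplanar) := by
  -- `IsBipartiteWith` constrains only the ends of edges; that the parts cover `V` holds because no
  -- vertex is isolated.
  have hcov : ∀ v, v ∈ X ∨ v ∈ Y := by
    intro v
    obtain ⟨w, hw⟩ := hconn.preconnected.exists_adj_of_nontrivial v
    exact (hXY.mem_of_adj hw).imp And.left And.left
  obtain ⟨v⟩ := hconn.nonempty
  obtain ⟨w, hvw⟩ := hconn.preconnected.exists_adj_of_nontrivial v
  obtain ⟨x, y, hx, hy⟩ : ∃ x y, x ∈ X ∧ y ∈ Y :=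
    (hXY.mem_of_adj hvw).elim (fun h => ⟨v, w, h⟩) fun h => ⟨w, v, h.symm⟩
  have hX := hXY.supp_connectedComponentMk hconn hx
  have hY := hXY.symm.supp_connectedComponentMk hconn hy
  refine ⟨_, _, fun h => ?_, fun c => ?_, hX, hY, (hXY.isPlanar_toSimpleGraph hsub hX).1 hplanar,
    (hXY.symm.isPlanar_toSimpleGraph hsub hY).1 hplanar,
    fun h => ⟨(hXY.isPlanar_toSimpleGraph hsub hX).2 h,
      (hXY.symm.isPlanar_toSimpleGraph hsub hY).2 h⟩⟩
  · rw [h, hY] at hX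
    exact Set.disjoint_left.mp hXY.disjoint hx (hX ▸ hx)
  · induction c using SimpleGraph.ConnectedComponent.ind with
    | _ v =>
      rcases hcov v with hv | hv
      · left; rw [← SimpleGraph.ConnectedComponent.mem_supp_iff, hX]; exact hv
      · right; rw [← SimpleGraph.ConnectedComponent.mem_supp_iff, hY]; exact hv
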